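/- Let $N\ge 5$ and $2^{**}:=\frac{2N}{N-4}$. Let $\mathcal D^{2,2}(\mathbb R^N)$ be the completion of $C_0^\infty(\mathbb R^N)$ (real-valued) with respect to the norm $\|u\|_{\mathcal D^{2,2}}:=\bigl(\sum_{|\alpha|=2}\|\partial^\alpha u\|_{L^2(\mathbb R^N)}^2\bigr)^{1/2}$, whose elements are regarded as functions through the Sobolev embedding $\mathcal D^{2,2}(\mathbb R^N)\subset L^{2^{**}}(\mathbb R^N)$. Let $\mathcal P$ be the set of all continuous $\Psi:\mathbb R\to\mathbb R$ with $$\lim_{s\to 0}\frac{\Psi(s)}{|s|^{2^{**}}}=\lim_{|s|\to\infty}\frac{\Psi(s)}{|s|^{2^{**}}}=0 .$$ Then: (0) $\Psi(u)\in L^1(\mathbb R^N)$ for every $u\in\mathcal D^{2,2}(\mathbb R^N)$ and every $\Psi\in\mathcal P$. (1) If $(u_n)$ is a bounded sequence in $\mathcal D^{2,2}(\mathbb R^N)$ and for some $r>0$ $$\lim_{n\to\infty}\ \sup_{y\in\mathbb R^N}\int_{B(y,r)}|u_n|^2\,dx=0,$$ then $\int_{\mathbb R^N}\Psi(u_n)\,dx\to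 0$ as $n\to\infty$ for every $\Psi\in\mathcal P$. (2) If $(u_n)$ is a bounded sequence in $\mathcal D^{2,2}(\mathbb R^N)$, then $u_n(\cdot+y_n)\rightharpoonup 0$ weakly in $\mathcal D^{2,2}(\mathbb R^N)$ for every sequence $(y_n)$ in $\mathbb Z^N$ if and only if $\int_{\mathbb R^N}\Psi(u_n)\,dx\to 0$ as $n\to\infty$ for every $\Psi\in\mathcal P$. -/

import Mathlib

open MeasureTheory Filter Topology
open scoped ENNReal NNReal ContDiff

noncomputable section

namespace Biharmonic

/-- `ℝ^N` with the Euclidean norm and Lebesgue measure. -/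
abbrev RN (N : ℕ) : Type := EuclideanSpace ℝ (Fin N)

/-- The critical exponent `2** = 2N / (N - 4)`. -/
def critExp (N : ℕ) : ℝ := 2 * (N : ℝ) / ((N : ℝ) - 4)

/-- The partial derivative `∂_i f`. -/
def partialD {N : ℕ} (i : Fin N) (f : RN N → ℝ) : RN N → ℝ :=
  fun x => fderiv ℝ f x (EuclideanSpace.single i 1)

/-- The indices `i ≤ j` of the second order partial derivatives `∂^α = ∂_i ∂_j`, `|α| = 2`
(every multi-index of length two occurs exactly once). -/
def idx2 (N : ℕ) : Finset (Fin N × Fin N) := Finset.univ.filter fun p => p.1 ≤ p.2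

/-- `C_0^∞(ℝ^N)` as a space of functions. -/
def testSubmodule (N : ℕ) : Submodule ℝ (RN N → ℝ) where
  carrier := {f | ContDiff ℝ ∞ f ∧ HasCompactSupport f}
  add_mem' hf hg := ⟨hf.1.add hg.1, hf.2.add hg.2⟩
  zero_mem' := ⟨contDiff_const, HasCompactSupport.zero⟩
  smul_mem' c _ hf := ⟨contDiff_const.smul hf.1, hf.2.smul_left (f := fun _ => c)⟩

/-- `C_0^∞(ℝ^N)`, as a type of its own so that it can carry the norm of `𝓓^{2,2}`
(and not the topology of pointwise convergence). -/
def TestFun (N : ℕ) : Type := testSubmodule N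

namespace TestFun

variable {N : ℕ}

instance : AddCommGroup (TestFun N) := inferInstanceAs (AddCommGroup (testSubmodule N))
instance : Module ℝ (TestFun N) := inferInstanceAs (Module ℝ (testSubmodule N))

/-- The underlying function of a test function. -/
def toFun (f : TestFun N) : RN N → ℝ := Subtype.val (p := (· ∈ testSubmodule N)) f

instance : CoeFun (TestFun N) (fun _ => RN N → ℝ) := ⟨toFun⟩

theorem contDiff (f : TestFun N) : ContDiff ℝ ∞ f :=
  (Subtype.property (p := (· ∈ testSubmodule N)) f).1
theorem hasCompactSupport (f : TestFun N) : HasCompactSupport f :=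
  (Subtype.property (p := (· ∈ testSubmodule N)) f).2
theorem add_coe (f g : TestFun N) : ⇑(f + g) = ⇑f + ⇑g := rfl
theorem smul_coe (c : ℝ) (f : TestFun N) : ⇑(c • f) = c • ⇑f := rfl

end TestFun

section PartialD

variable {N : ℕ}

theorem contDiff_partialD {f : RN N → ℝ} (hf : ContDiff ℝ ∞ f) (i : Fin N) :
    ContDiff ℝ ∞ (partialD i f) :=
  (hf.fderiv_right (m := ∞) (by simp)).clm_apply contDiff_const

theorem hasCompactSupport_partialD {f : RN N → ℝ} (hf : HasCompactSupport f) (i : Fin N) :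
    HasCompactSupport (partialD i f) :=
  hf.fderiv_apply (𝕜 := ℝ) _

theorem partialD_add {f g : RN N → ℝ} (hf : ContDiff ℝ ∞ f) (hg : ContDiff ℝ ∞ g) (i : Fin N) :
    partialD i (f + g) = partialD i f + partialD i g := by
  funext x
  simp only [partialD, Pi.add_apply]
  rw [fderiv_add (hf.differentiable (by simp) x) (hg.differentiable (by simp) x)]
  rfl

theorem partialD_smul {f : RN N → ℝ} (hf : ContDiff ℝ ∞ f) (c : ℝ) (i : Fin N) :
    partialD i (c • f) = c • partialD i f := by
  funext x
  simp only [partialD, Pi.smul_apply]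
  rw [fderiv_const_smul (hf.differentiable (by simp) x)]
  rfl

theorem partialD_comp_add (f : RN N → ℝ) (y : RN N) (i : Fin N) :
    partialD i (fun x => f (x + y)) = fun x => partialD i f (x + y) := by
  funext x
  simp only [partialD, fderiv_comp_add_right]

end PartialD

namespace TestFun

variable {N : ℕ}

/-- The second order partial derivative `∂_i ∂_j f`. -/
def d2 (f : TestFun N) (p : Fin N × Fin N) : RN N → ℝ := partialD p.1 (partialD p.2 f)

theorem continuous_d2 (f : TestFun N) (p : Fin N × Fin N) : Continuous (f.d2 p) :=
  (contDiff_partialD (contDiff_partialD f.contDiff _) _).continuous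

theorem hasCompactSupport_d2 (f : TestFun N) (p : Fin N × Fin N) : HasCompactSupport (f.d2 p) :=
  hasCompactSupport_partialD (hasCompactSupport_partialD f.hasCompactSupport _) _

theorem d2_add (f g : TestFun N) (p : Fin N × Fin N) : (f + g).d2 p = f.d2 p + g.d2 p := by
  unfold d2
  rw [add_coe, partialD_add f.contDiff g.contDiff,
    partialD_add (contDiff_partialD f.contDiff _) (contDiff_partialD g.contDiff _)]

theorem d2_smul (c : ℝ) (f : TestFun N) (p : Fin N × Fin N) : (c • f).d2 p = c • f.d2 p := by
  unfold d2
  rw [smul_coe, partialD_smul f.contDiff, partialD_smul (contDiff_partialD f.contDiff _)]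

theorem integrable_d2_mul (f g : TestFun N) (p : Fin N × Fin N) :
    Integrable (fun x => f.d2 p x * g.d2 p x) :=
  ((f.continuous_d2 p).mul (g.continuous_d2 p)).integrable_of_hasCompactSupport
    ((f.hasCompactSupport_d2 p).mul_right)

/-- The inner product `∑_{|α|=2} ∫ ∂^α f ∂^α g` on `C_0^∞(ℝ^N)`; the norm it induces is
`(∑_{|α|=2} ‖∂^α f‖_{L²}²)^{1/2}`. -/
@[reducible] def innerCore (N : ℕ) : PreInnerProductSpace.Core ℝ (TestFun N) where
  inner f g := ∑ p ∈ idx2 N, ∫ x, f.d2 p x * g.d2 p x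
  conj_inner_symm f g := by simp [mul_comm]
  re_inner_nonneg f :=
    Finset.sum_nonneg fun p _ => integral_nonneg fun x => mul_self_nonneg _
  add_left f g h := by
    rw [← Finset.sum_add_distrib]
    refine Finset.sum_congr rfl fun p _ => ?_
    rw [← integral_add (integrable_d2_mul f h p) (integrable_d2_mul g h p)]
    simp [d2_add, add_mul]
  smul_left f g c := by
    rw [conj_trivial, Finset.mul_sum]
    refine Finset.sum_congr rfl fun p _ => ?_
    rw [← integral_const_mul]
    simp [d2_smul, mul_assoc]

instance : SeminormedAddCommGroup (TestFun N) :=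
  @InnerProductSpace.Core.toSeminormedAddCommGroup ℝ (TestFun N) _ _ _ (innerCore N)

instance : InnerProductSpace ℝ (TestFun N) := InnerProductSpace.ofCore (innerCore N)

theorem norm_sq (f : TestFun N) : ‖f‖ ^ 2 = ∑ p ∈ idx2 N, ∫ x, f.d2 p x ^ 2 := by
  rw [← real_inner_self_eq_norm_sq]
  change ∑ p ∈ idx2 N, ∫ x, f.d2 p x * f.d2 p x = _
  simp [sq]

/-- The translate `f(· + y)` of a test function. -/
def translate (y : RN N) : TestFun N →ₗ[ℝ] TestFun N where
  toFun f := ⟨fun x => f (x + y), f.contDiff.comp (contDiff_id.add contDiff_const),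
    f.hasCompactSupport.comp_homeomorph (Homeomorph.addRight y)⟩
  map_add' _ _ := rfl
  map_smul' _ _ := rfl

theorem norm_translate (y : RN N) (f : TestFun N) : ‖translate y f‖ = ‖f‖ := by
  rw [← sq_eq_sq₀ (norm_nonneg _) (norm_nonneg _), norm_sq, norm_sq]
  refine Finset.sum_congr rfl fun p _ => ?_
  have h : (translate y f).d2 p = fun x => f.d2 p (x + y) := by
    change partialD p.1 (partialD p.2 (fun x => f (x + y))) = _
    rw [partialD_comp_add, partialD_comp_add]
    rfl
  rw [h]
  exact integral_add_right_eq_self (fun x => f.d2 p x ^ 2) y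

end TestFun

/-- `𝓓^{2,2}(ℝ^N)`: the completion of `C_0^∞(ℝ^N)` in the norm
`(∑_{|α|=2} ‖∂^α u‖_{L²}²)^{1/2}`. -/
abbrev D22 (N : ℕ) : Type := UniformSpace.Completion (TestFun N)

section Sobolev

variable {N : ℕ}

theorem one_le_critExp [h : Fact (5 ≤ N)] : 1 ≤ critExp N := by
  have h5 : (5 : ℝ) ≤ N := by exact_mod_cast h.out
  rw [critExp, le_div_iff₀ (by linarith)]
  linarith

instance [Fact (5 ≤ N)] : Fact (1 ≤ ENNReal.ofReal (critExp N)) :=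
  ⟨by simpa using ENNReal.ofReal_le_ofReal (one_le_critExp (N := N))⟩

theorem opNorm_le_sum {F : Type*} [NormedAddCommGroup F] [NormedSpace ℝ F]
    (A : RN N →L[ℝ] F) : ‖A‖ ≤ ∑ i, ‖A (EuclideanSpace.single i 1)‖ := by
  refine A.opNorm_le_bound (Finset.sum_nonneg fun _ _ => norm_nonneg _) fun v => ?_
  have hv : v = ∑ i, v i • EuclideanSpace.single i (1 : ℝ) := by
    ext j
    simp [Pi.single_apply]
  conv_lhs => rw [hv]
  rw [map_sum, Finset.sum_mul]
  refine (norm_sum_le _ _).trans (Finset.sum_le_sum fun i _ => ?_)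
  rw [map_smul, norm_smul, mul_comm]
  exact mul_le_mul_of_nonneg_left (PiLp.norm_apply_le v i) (norm_nonneg _)

theorem opNorm_le_sum_sum (A : RN N →L[ℝ] RN N →L[ℝ] ℝ) :
    ‖A‖ ≤ ∑ p : Fin N × Fin N,
      ‖A (EuclideanSpace.single p.1 1) (EuclideanSpace.single p.2 1)‖ := by
  rw [Fintype.sum_prod_type]
  exact (opNorm_le_sum A).trans (Finset.sum_le_sum fun i _ => opNorm_le_sum _)

theorem TestFun.d2_eq (f : TestFun N) (p : Fin N × Fin N) (x : RN N) :
    f.d2 p x = fderiv ℝ (fderiv ℝ f) x (EuclideanSpace.single p.1 1)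
      (EuclideanSpace.single p.2 1) := by
  have hd : DifferentiableAt ℝ (fderiv ℝ f) x :=
    (f.contDiff.fderiv_right (m := ∞) (by simp)).differentiable (by simp) x
  change fderiv ℝ (fun y => fderiv ℝ f y (EuclideanSpace.single p.2 1)) x _ = _
  rw [fderiv_clm_apply hd (differentiableAt_const _)]
  simp

theorem TestFun.d2_swap (f : TestFun N) (p : Fin N × Fin N) : f.d2 p.swap = f.d2 p := by
  funext x
  rw [d2_eq, d2_eq]
  have h : IsSymmSndFDerivAt ℝ f x :=
    (f.contDiff.contDiffAt).isSymmSndFDerivAt (by simp; norm_cast)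
  exact h.eq _ _

theorem TestFun.eLpNorm_d2_le (f : TestFun N) (p : Fin N × Fin N) :
    eLpNorm (f.d2 p) 2 volume ≤ ENNReal.ofReal ‖f‖ := by
  wlog hp : p.1 ≤ p.2 generalizing p
  · rw [← f.d2_swap p]
    exact this p.swap (le_of_lt (not_le.1 hp))
  have hm : MemLp (f.d2 p) 2 volume :=
    (f.continuous_d2 p).memLp_of_hasCompactSupport (f.hasCompactSupport_d2 p)
  rw [hm.eLpNorm_eq_integral_rpow_norm (by simp) (by simp)]
  refine ENNReal.ofReal_le_ofReal ?_
  have h2 : ∫ x, ‖f.d2 p x‖ ^ (2 : ℝ≥0∞).toReal ≤ ‖f‖ ^ 2 := by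
    rw [f.norm_sq]
    have := Finset.single_le_sum (f := fun p => ∫ x, f.d2 p x ^ 2) (s := idx2 N)
      (fun p _ => integral_nonneg fun x => sq_nonneg _)
      (show p ∈ idx2 N by simp [idx2, hp])
    simpa using this
  calc _ ≤ (‖f‖ ^ 2) ^ ((2 : ℝ≥0∞).toReal)⁻¹ :=
        Real.rpow_le_rpow (integral_nonneg fun x => by positivity) h2 (by simp)
    _ = ‖f‖ := by
        rw [← Real.rpow_natCast, ← Real.rpow_mul (norm_nonneg _)]
        simp

theorem TestFun.eLpNorm_fderiv_fderiv_le (f : TestFun N) :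
    eLpNorm (fderiv ℝ (fderiv ℝ f)) 2 volume
      ≤ (Fintype.card (Fin N × Fin N) : ℝ≥0∞) * ENNReal.ofReal ‖f‖ := by
  let G : Fin N × Fin N → RN N → ℝ := fun p y => ‖f.d2 p y‖
  generalize hH : fderiv ℝ (fderiv ℝ f) = H
  have hb : ∀ x, ‖H x‖ ≤ (∑ p, G p) x := by
    intro x
    rw [← hH]
    refine (opNorm_le_sum_sum _).trans_eq ?_
    rw [Finset.sum_apply]
    exact Finset.sum_congr rfl fun p _ => by rw [← f.d2_eq]
  have h1 : eLpNorm H 2 volume ≤ eLpNorm (∑ p, G p) 2 volume :=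
    eLpNorm_mono_real (f := H) (g := ∑ p, G p) hb
  have h2 : eLpNorm (∑ p, G p) 2 volume ≤ ∑ p, eLpNorm (G p) 2 volume :=
    eLpNorm_sum_le (fun p _ => (f.continuous_d2 p).norm.aestronglyMeasurable) (by norm_num)
  have h3 : ∑ p, eLpNorm (G p) 2 volume ≤ ∑ _p : Fin N × Fin N, ENNReal.ofReal ‖f‖ :=
    Finset.sum_le_sum fun p _ => (eLpNorm_norm (f.d2 p)).trans_le (f.eLpNorm_d2_le p)
  have h4 : ∑ _p : Fin N × Fin N, ENNReal.ofReal ‖f‖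
      = (Fintype.card (Fin N × Fin N) : ℝ≥0∞) * ENNReal.ofReal ‖f‖ := by
    rw [Finset.sum_const, nsmul_eq_mul, Finset.card_univ]
  exact ((h1.trans h2).trans h3).trans_eq h4

/-- The Sobolev inequality `‖f‖_{L^{2**}} ≤ C ‖f‖_{𝓓^{2,2}}` for test functions. -/
theorem TestFun.sobolev (N : ℕ) [h : Fact (5 ≤ N)] : ∃ C : ℝ≥0, ∀ f : TestFun N,
    eLpNorm f (ENNReal.ofReal (critExp N)) volume ≤ C * ENNReal.ofReal ‖f‖ := by
  have h5 : (5 : ℝ) ≤ N := by exact_mod_cast h.out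
  have hfin : Module.finrank ℝ (RN N) = N := by simp
  let q : ℝ≥0 := ⟨2 * N / (N - 2), div_nonneg (by positivity) (by linarith)⟩
  let r : ℝ≥0 := Real.toNNReal (critExp N)
  have hr : (r : ℝ) = 2 * N / (N - 4) :=
    Real.coe_toNNReal _ (zero_le_one.trans one_le_critExp)
  have hq1 : 1 ≤ q := by
    rw [← NNReal.coe_le_coe]
    change (1 : ℝ) ≤ 2 * N / (N - 2)
    rw [le_div_iff₀ (by linarith)]
    linarith
  have hq : (q : ℝ)⁻¹ = ((2 : ℝ≥0) : ℝ)⁻¹ - (Module.finrank ℝ (RN N) : ℝ)⁻¹ := by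
    rw [hfin]
    change (2 * (N : ℝ) / (N - 2))⁻¹ = (2 : ℝ)⁻¹ - _
    have : (N : ℝ) - 2 ≠ 0 := by linarith
    field_simp
  have hr' : (r : ℝ)⁻¹ = (q : ℝ)⁻¹ - (Module.finrank ℝ (RN N) : ℝ)⁻¹ := by
    rw [hfin, hr]
    change _ = (2 * (N : ℝ) / (N - 2))⁻¹ - _
    have : (N : ℝ) - 2 ≠ 0 := by linarith
    have : (N : ℝ) - 4 ≠ 0 := by linarith
    field_simp
    ring
  have hpos : 0 < Module.finrank ℝ (RN N) := by rw [hfin]; linarith [h.out]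
  let C₁ := SNormLESNormFDerivOfEqConst ℝ (volume : Measure (RN N)) q
  let C₂ := SNormLESNormFDerivOfEqConst (RN N →L[ℝ] ℝ) (volume : Measure (RN N)) 2
  refine ⟨C₁ * (C₂ * (Fintype.card (Fin N × Fin N) : ℝ≥0)), fun f => ?_⟩
  have hD : ContDiff ℝ ∞ (fderiv ℝ f) := f.contDiff.fderiv_right (m := ∞) (by simp)
  have s1 : eLpNorm f r volume ≤ C₁ * eLpNorm (fderiv ℝ f) q volume :=
    eLpNorm_le_eLpNorm_fderiv_of_eq volume (f.contDiff.of_le (by norm_cast))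
      f.hasCompactSupport hq1 hpos hr'
  have s2 : eLpNorm (fderiv ℝ f) q volume ≤ C₂ * eLpNorm (fderiv ℝ (fderiv ℝ f)) (2 : ℝ≥0) volume :=
    eLpNorm_le_eLpNorm_fderiv_of_eq volume (u := fderiv ℝ f) (hD.of_le (by norm_cast))
      (f.hasCompactSupport.fderiv (𝕜 := ℝ)) (by norm_num) hpos hq
  have s3 := f.eLpNorm_fderiv_fderiv_le
  calc eLpNorm f (ENNReal.ofReal (critExp N)) volume
      ≤ C₁ * eLpNorm (fderiv ℝ f) q volume := s1
    _ ≤ C₁ * (C₂ * ((Fintype.card (Fin N × Fin N) : ℝ≥0∞) * ENNReal.ofReal ‖f‖)) := by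
        exact mul_le_mul_right (s2.trans (mul_le_mul_right s3 _)) _
    _ = _ := by push_cast; ring

theorem TestFun.memLp (f : TestFun N) (p : ℝ≥0∞) : MemLp f p volume :=
  f.contDiff.continuous.memLp_of_hasCompactSupport f.hasCompactSupport

/-- A test function as an element of `L^{2**}(ℝ^N)`. -/
def TestFun.toLp [Fact (5 ≤ N)] :
    TestFun N →ₗ[ℝ] Lp ℝ (ENNReal.ofReal (critExp N)) (volume : Measure (RN N)) where
  toFun f := (f.memLp _).toLp f
  map_add' f g := MemLp.toLp_add (f.memLp _) (g.memLp _)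
  map_smul' c f := MemLp.toLp_const_smul c (f.memLp _)

theorem TestFun.norm_toLp_le (N : ℕ) [Fact (5 ≤ N)] : ∃ C : ℝ, ∀ f : TestFun N,
    ‖TestFun.toLp f‖ ≤ C * ‖(UniformSpace.Completion.toComplL (𝕜 := ℝ) f : D22 N)‖ := by
  obtain ⟨C, hC⟩ := TestFun.sobolev N
  refine ⟨C, fun f => ?_⟩
  have h := hC f
  change ‖(f.memLp _).toLp f‖ ≤ C * ‖((f : TestFun N) : D22 N)‖
  rw [UniformSpace.Completion.norm_coe, Lp.norm_toLp]
  refine ENNReal.toReal_le_of_le_ofReal (by positivity) ?_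
  rwa [ENNReal.ofReal_mul (by positivity), ENNReal.ofReal_coe_nnreal]

end Sobolev

namespace D22

variable {N : ℕ}

/-- The Sobolev embedding `𝓓^{2,2}(ℝ^N) → L^{2**}(ℝ^N)`: the continuous extension of the
inclusion of `C_0^∞(ℝ^N)`. It realizes the elements of the completion as functions. -/
def toLp [Fact (5 ≤ N)] :
    D22 N →L[ℝ] Lp ℝ (ENNReal.ofReal (critExp N)) (volume : Measure (RN N)) :=
  (TestFun.toLp (N := N)).extendOfNorm
    (UniformSpace.Completion.toComplL (𝕜 := ℝ) : TestFun N →L[ℝ] D22 N).toLinearMap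

theorem toLp_coe [Fact (5 ≤ N)] (f : TestFun N) : toLp (f : D22 N) = TestFun.toLp f :=
  LinearMap.extendOfNorm_eq (f := TestFun.toLp (N := N))
    (e := (UniformSpace.Completion.toComplL (𝕜 := ℝ) : TestFun N →L[ℝ] D22 N).toLinearMap)
    UniformSpace.Completion.denseRange_coe (TestFun.norm_toLp_le N) f

/-- An element of `𝓓^{2,2}(ℝ^N)` as a function on `ℝ^N` (defined up to null sets). -/
instance [Fact (5 ≤ N)] : CoeFun (D22 N) (fun _ => RN N → ℝ) := ⟨fun u => toLp u⟩

/-- The translate `u(· + y)` in `𝓓^{2,2}(ℝ^N)`: the continuous extension of the translation of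
test functions. -/
def translate (y : RN N) : D22 N →L[ℝ] D22 N :=
  ((UniformSpace.Completion.toComplL (𝕜 := ℝ) : TestFun N →L[ℝ] D22 N).toLinearMap ∘ₗ
    TestFun.translate y).extendOfNorm
    (UniformSpace.Completion.toComplL (𝕜 := ℝ) : TestFun N →L[ℝ] D22 N).toLinearMap

theorem translate_coe (y : RN N) (f : TestFun N) :
    translate y (f : D22 N) = (TestFun.translate y f : TestFun N) :=
  LinearMap.extendOfNorm_eq
    (f := (UniformSpace.Completion.toComplL (𝕜 := ℝ) : TestFun N →L[ℝ] D22 N).toLinearMap ∘ₗ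
      TestFun.translate y)
    (e := (UniformSpace.Completion.toComplL (𝕜 := ℝ) : TestFun N →L[ℝ] D22 N).toLinearMap)
    UniformSpace.Completion.denseRange_coe
    ⟨1, fun g => by
      change ‖((TestFun.translate y g : TestFun N) : D22 N)‖ ≤ 1 * ‖(g : D22 N)‖
      rw [UniformSpace.Completion.norm_coe, UniformSpace.Completion.norm_coe,
        TestFun.norm_translate, one_mul]⟩ f

/-- `translate y u` is, as a function, `u(· + y)`. -/
theorem translate_ae_eq [Fact (5 ≤ N)] (y : RN N) (u : D22 N) :
    (translate y u : RN N → ℝ) =ᵐ[volume] fun x => u (x + y) := by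
  have hmp : MeasurePreserving (fun x : RN N => x + y) volume volume :=
    measurePreserving_add_right volume y
  have key : toLp (translate y u) = Lp.compMeasurePreserving (fun x => x + y) hmp (toLp u) := by
    induction u using UniformSpace.Completion.induction_on with
    | hp =>
      refine isClosed_eq (toLp.continuous.comp (translate y).continuous) ?_
      exact (Lp.isometry_compMeasurePreserving hmp).continuous.comp toLp.continuous
    | ih f =>
      rw [translate_coe, toLp_coe, toLp_coe]
      exact (Lp.toLp_compMeasurePreserving (f.memLp _) hmp).symm
  rw [key]
  exact Lp.coeFn_compMeasurePreserving _ hmp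

end D22

/-- The point of `ℝ^N` with the integer coordinates `k`. -/
def ofInt {N : ℕ} (k : Fin N → ℤ) : RN N := WithLp.toLp 2 fun i => (k i : ℝ)

/-- The condition on the nonlinearity: `Ψ` is continuous and `Ψ(s) / |s|^{2**} → 0` both as
`s → 0` and as `|s| → ∞`. -/
structure IsSubcritical (N : ℕ) (Ψ : ℝ → ℝ) : Prop where
  continuous : Continuous Ψ
  tendsto_zero : Tendsto (fun s => Ψ s / |s| ^ critExp N) (𝓝[≠] 0) (𝓝 0)
  tendsto_infty : Tendsto (fun s => Ψ s / |s| ^ critExp N) (comap (fun s : ℝ => |s|) atTop) (𝓝 0)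

end Biharmonic

end

/-! Everything passes through one condition on a bounded sequence: for each `a > 0`, the measure of
`{|u n| ≥ a}` tends to `0`. Write `p` for `critExp N`.

For bounded sequences this condition is equivalent to `∫ Ψ(u n) → 0` for all subcritical `Ψ`. One
direction splits `|Ψ s| ≤ ε |s| ^ p + K 1_{|s| ≥ a}` (`IsSubcritical.abs_le`), the `ε`-term being
controlled by the Sobolev embedding. The other takes the single nonlinearity `min (|s| ^ (p + 1)) 1`
and Chebyshev's inequality.

The Lions lemma says that smallness on balls, `sup_y |B(y, r) ∩ {|u n| ≥ a}| → 0` for all `a`,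
already gives global smallness (`D22.tendsto_measure_of_tendsto_iSup_ball`). A function `w`
supported in `s` satisfies `‖w‖₁ ≤ K δ ^ (1/N) (‖w‖₁ + ‖∇w‖₁)` when every `r`-ball meets `s` in
measure at most `δ`: apply the `W^{1,1}` Sobolev inequality to a localization of `w`, gain `δ ^
(1/N)` by Hölder, and average over all centres. With `w` a truncation of `u n`, `s` is a superlevel
set, of bounded measure by Chebyshev, and `‖∇w‖₁` is bounded because the gradient lies in
`L^{2N/(N-2)}`.

Smallness on balls follows from the `L²` hypothesis by Chebyshev. It also follows from weak
convergence of integer translates: the sup over centres is nearly attained along some lattice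
sequence, and local compactness (`D22.tendsto_measure_ball_inter`) applies to the translates along
it. Conversely, convergence in measure is translation invariant, and for bounded sequences it
implies weak convergence to `0`: test functions are dense in the dual, and pairing with one is
integration against a `C_c` function. -/

namespace Biharmonic

/-! ### Measure-theoretic inequalities: Hölder, Chebyshev, superlevel sets. -/

section General

/-- A nonnegative sequence tends to `0` if, up to a null sequence, it is at most `ε C`
for every `ε > 0`. -/
theorem tendsto_zero_of_le_add {x : ℕ → ℝ≥0∞} {C : ℝ≥0∞} (hC : C ≠ ⊤)
    (h : ∀ ε : ℝ, 0 < ε → ∃ b : ℕ → ℝ≥0∞, Tendsto b atTop (𝓝 0) ∧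
      ∀ n, x n ≤ ENNReal.ofReal ε * C + b n) : Tendsto x atTop (𝓝 0) := by
  rw [ENNReal.tendsto_nhds_zero]
  intro δ hδ
  obtain ⟨δ', hδ', hle⟩ : ∃ δ' : ℝ, 0 < δ' ∧ ENNReal.ofReal δ' ≤ δ / 2 := by
    by_cases hT : δ = ⊤
    · exact ⟨1, one_pos, by simp [hT, ENNReal.top_div]⟩
    · refine ⟨(δ / 2).toReal, ENNReal.toReal_pos (by simpa using hδ.ne') ?_, ?_⟩
      · exact (ENNReal.div_lt_top hT (by norm_num)).ne
      · exact ENNReal.ofReal_toReal_le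
  have hpos : 0 < C.toReal + 1 := by positivity
  -- The `+ 1` keeps the divisor positive when `C = 0`.
  obtain ⟨b, hb, hx⟩ := h (δ' / (C.toReal + 1)) (by positivity)
  have h1 : ENNReal.ofReal (δ' / (C.toReal + 1)) * C ≤ δ / 2 := by
    refine le_trans ?_ hle
    rw [← ENNReal.ofReal_toReal hC, ← ENNReal.ofReal_mul (by positivity),
      ENNReal.ofReal_toReal hC]
    refine ENNReal.ofReal_le_ofReal ?_
    rw [div_mul_eq_mul_div, div_le_iff₀ hpos]
    nlinarith [ENNReal.toReal_nonneg (a := C)]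
  have h2 : ∀ᶠ n in atTop, b n ≤ δ / 2 :=
    ENNReal.tendsto_nhds_zero.1 hb _ (ENNReal.half_pos hδ.ne')
  filter_upwards [h2] with n hn
  exact (hx n).trans ((add_le_add h1 hn).trans_eq (ENNReal.add_halves δ))

/-- Hölder against the constant `1` on `s`. The power of `μ s` is what turns small or bounded
superlevel sets into small or bounded integrals. -/
theorem setLIntegral_enorm_le {α F : Type*} [MeasurableSpace α] [NormedAddCommGroup F]
    {μ : Measure α} {f : α → F} (hf : AEStronglyMeasurable f μ) {p : ℝ≥0∞} (hp : 1 ≤ p)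
    (s : Set α) :
    ∫⁻ x in s, ‖f x‖ₑ ∂μ ≤ eLpNorm f p μ * μ s ^ (1 - 1 / p.toReal) := by
  rw [← eLpNorm_one_eq_lintegral_enorm]
  refine (eLpNorm_le_eLpNorm_mul_rpow_measure_univ hp hf.restrict).trans ?_
  simp only [Measure.restrict_apply_univ, ENNReal.toReal_one, div_one]
  gcongr
  exact Measure.restrict_le_self

/-- Chebyshev's inequality for `μ.restrict s`. It is applied to `u ^ 2`, to `Ψ(u)` and to the
difference between a function and its ball mean. -/
theorem measure_inter_abs_ge_le {α : Type*} [MeasurableSpace α] {μ : Measure α} {f : α → ℝ}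
    (hf : AEStronglyMeasurable f μ) {s : Set α} (hs : MeasurableSet s) {a : ℝ} (ha : 0 < a) :
    μ (s ∩ {x | a ≤ |f x|}) ≤ (ENNReal.ofReal a)⁻¹ * ∫⁻ x in s, ‖f x‖ₑ ∂μ := by
  have h := mul_meas_ge_le_lintegral₀ (μ := μ.restrict s) hf.restrict.enorm (ENNReal.ofReal a)
  rw [Measure.restrict_apply' hs, Set.inter_comm] at h
  have hset : {x | ENNReal.ofReal a ≤ ‖f x‖ₑ} = {x | a ≤ |f x|} := by
    ext x
    simp only [Set.mem_ofPred_eq, Real.enorm_eq_ofReal_abs]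
    rw [ENNReal.ofReal_le_ofReal_iff (abs_nonneg _)]
  rw [hset] at h
  have ha' : ENNReal.ofReal a ≠ 0 := by simpa using ha
  calc μ (s ∩ {x | a ≤ |f x|})
      = (ENNReal.ofReal a)⁻¹ * (ENNReal.ofReal a * μ (s ∩ {x | a ≤ |f x|})) := by
        rw [← mul_assoc, ENNReal.inv_mul_cancel ha' ENNReal.ofReal_ne_top, one_mul]
    _ ≤ _ := by gcongr

/-- If both `|g|` and `|d|` are below `a / 2`, then `|f| < a`. The relation holds only a.e. because
a difference in `D22 N` is a pointwise difference only up to null sets. -/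
theorem measure_inter_abs_ge_le_add {α : Type*} [MeasurableSpace α] {μ : Measure α}
    {f g d : α → ℝ} (hd : d =ᵐ[μ] fun x => f x - g x) (s : Set α) (a : ℝ) :
    μ (s ∩ {x | a ≤ |f x|})
      ≤ μ (s ∩ {x | a / 2 ≤ |g x|}) + μ (s ∩ {x | a / 2 ≤ |d x|}) := by
  refine le_trans (measure_mono_ae ?_) (measure_union_le _ _)
  filter_upwards [hd] with x hx
  rintro ⟨hs, ha⟩
  change a ≤ |f x| at ha
  by_cases h : a / 2 ≤ |g x|
  · exact Or.inl ⟨hs, h⟩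
  · refine Or.inr ⟨hs, ?_⟩
    change a / 2 ≤ |d x|
    rw [hx]
    have := abs_sub_abs_le_abs_sub (f x) (g x)
    push Not at h
    linarith

end General

/-! ### Subcritical nonlinearities: pointwise bounds and an example. -/

section Subcritical

variable {N : ℕ}

theorem critExp_pos [Fact (5 ≤ N)] : 0 < critExp N := one_pos.trans_le one_le_critExp

theorem one_lt_critExp [h : Fact (5 ≤ N)] : 1 < critExp N := by
  have h5 : (5 : ℝ) ≤ N := by exact_mod_cast h.out
  rw [critExp, lt_div_iff₀ (by linarith)]
  linarith

theorem toReal_critExp [Fact (5 ≤ N)] : (ENNReal.ofReal (critExp N)).toReal = critExp N :=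
  ENNReal.toReal_ofReal critExp_pos.le

/-- Away from `0`, a subcritical nonlinearity is an arbitrarily small multiple of `|s|^{2**}`
up to a bounded error. -/
theorem IsSubcritical.abs_le [Fact (5 ≤ N)] {Ψ : ℝ → ℝ} (hΨ : IsSubcritical N Ψ) {ε : ℝ}
    (hε : 0 < ε) : ∃ a > 0, ∃ K : ℝ, 0 ≤ K ∧ ∀ s, |Ψ s| ≤ ε * |s| ^ critExp N +
      {s : ℝ | a ≤ |s|}.indicator (fun _ => K) s := by
  have hp := critExp_pos (N := N)
  have key : ∀ s, s ≠ 0 → dist (Ψ s / |s| ^ critExp N) 0 < ε → |Ψ s| ≤ ε * |s| ^ critExp N := by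
    intro s hs h
    have h' : 0 < |s| ^ critExp N := Real.rpow_pos_of_pos (abs_pos.2 hs) _
    rw [Real.dist_eq, sub_zero, abs_div, abs_of_pos h', div_lt_iff₀ h'] at h
    exact h.le
  -- The limits say nothing at `s = 0`, where the claimed bound is `0`; continuity fills the gap.
  have h0 : Ψ 0 = 0 := by
    have h1 : Tendsto Ψ (𝓝[≠] 0) (𝓝 (Ψ 0)) := hΨ.continuous.continuousAt.tendsto.mono_left
      nhdsWithin_le_nhds
    have h2 : Tendsto (fun s : ℝ => Ψ s / |s| ^ critExp N * |s| ^ critExp N) (𝓝[≠] 0)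
        (𝓝 (0 * |(0 : ℝ)| ^ critExp N)) := by
      refine hΨ.tendsto_zero.mul (Tendsto.mono_left ?_ nhdsWithin_le_nhds)
      exact (continuous_abs.rpow_const fun _ => Or.inr hp.le).tendsto 0
    rw [zero_mul] at h2
    refine tendsto_nhds_unique h1 (h2.congr' ?_)
    filter_upwards [self_mem_nhdsWithin] with s hs
    exact div_mul_cancel₀ _ (Real.rpow_pos_of_pos (abs_pos.2 hs) _).ne'
  obtain ⟨a, ha, hA⟩ := Metric.mem_nhdsWithin_iff.1 (Metric.tendsto_nhds.1 hΨ.tendsto_zero ε hε)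
  obtain ⟨b, hb⟩ := (((Metric.tendsto_nhds.1 hΨ.tendsto_infty ε hε).filter_mono le_rfl)
    |> eventually_comap.1 |> eventually_atTop.1)
  obtain ⟨K, hK⟩ := (isCompact_Icc (a := -b) (b := b)).exists_bound_of_continuousOn
    hΨ.continuous.continuousOn
  -- The absolute value is needed since `[-b, b]` may be empty, in which case `K` has no sign.
  refine ⟨a, ha, |K|, abs_nonneg _, fun s => ?_⟩
  have hnn : 0 ≤ ε * |s| ^ critExp N := by positivity
  by_cases has : a ≤ |s|
  · rw [Set.indicator_of_mem (show s ∈ {s : ℝ | a ≤ |s|} from has)]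
    by_cases hbs : b ≤ |s|
    · have := key s (abs_pos.1 (ha.trans_le has)) (hb |s| hbs s rfl)
      linarith [abs_nonneg K]
    · have := hK s (_root_.abs_le.1 (not_le.1 hbs).le)
      rw [Real.norm_eq_abs] at this
      linarith [le_abs_self K]
  · rw [Set.indicator_of_notMem (show s ∉ {s : ℝ | a ≤ |s|} from has), add_zero]
    by_cases hs : s = 0
    · rw [hs, h0, abs_zero]; positivity
    · exact key s hs (hA ⟨by simpa using has, hs⟩)

/-- The extra power makes the quotient vanish at `0`, the cap makes it vanish at infinity. Being
nondecreasing in `|s|` and positive away from `0`, this nonlinearity detects the measure of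
superlevel sets. -/
theorem isSubcritical_min (N : ℕ) [Fact (5 ≤ N)] :
    IsSubcritical N fun s => min (|s| ^ (critExp N + 1)) 1 := by
  have hp := critExp_pos (N := N)
  have hnn : ∀ s : ℝ, 0 ≤ min (|s| ^ (critExp N + 1)) 1 / |s| ^ critExp N := fun s => by positivity
  refine ⟨(continuous_abs.rpow_const fun _ => Or.inr (by linarith)).min continuous_const, ?_, ?_⟩
  · have hlim : Tendsto (fun s : ℝ => |s|) (𝓝[≠] 0) (𝓝 0) := by
      simpa using (continuous_abs.tendsto (0 : ℝ)).mono_left nhdsWithin_le_nhds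
    refine tendsto_of_tendsto_of_tendsto_of_le_of_le' tendsto_const_nhds hlim
      (Eventually.of_forall hnn) ?_
    filter_upwards [self_mem_nhdsWithin] with s hs
    have hs' := abs_pos.2 hs
    rw [div_le_iff₀ (Real.rpow_pos_of_pos hs' _)]
    refine (min_le_left _ _).trans_eq ?_
    rw [Real.rpow_add hs', Real.rpow_one, mul_comm]
  · have hlim : Tendsto (fun s : ℝ => |s| ^ (-critExp N)) (comap (fun s : ℝ => |s|) atTop) (𝓝 0) :=
      (tendsto_rpow_neg_atTop hp).comp tendsto_comap
    refine squeeze_zero hnn (fun s => ?_) hlim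
    rw [Real.rpow_neg (abs_nonneg _), ← one_div]
    gcongr
    exact min_le_right _ _

end Subcritical

/-! ### Convergence in measure versus convergence of `∫ Ψ(u n)`. -/

section Measure

variable {N : ℕ} [Fact (5 ≤ N)]

theorem D22.memLp (u : D22 N) : MemLp (u : RN N → ℝ) (ENNReal.ofReal (critExp N)) volume :=
  Lp.memLp _

theorem D22.aestronglyMeasurable (u : D22 N) : AEStronglyMeasurable (u : RN N → ℝ) volume :=
  u.memLp.1

theorem D22.coe_ae_eq (f : TestFun N) : ((f : D22 N) : RN N → ℝ) =ᵐ[volume] f := by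
  rw [D22.toLp_coe]
  exact MemLp.coeFn_toLp (f.memLp _)

theorem D22.sub_ae_eq (u v : D22 N) :
    ((u - v : D22 N) : RN N → ℝ) =ᵐ[volume] fun x => u x - v x := by
  rw [map_sub]
  exact Lp.coeFn_sub _ _

theorem D22.eLpNorm_le (u : D22 N) : eLpNorm (u : RN N → ℝ) (ENNReal.ofReal (critExp N)) volume
    ≤ ENNReal.ofReal (‖D22.toLp (N := N)‖ * ‖u‖) := by
  rw [← ENNReal.ofReal_toReal u.memLp.2.ne]
  refine ENNReal.ofReal_le_ofReal ?_
  rw [← Lp.norm_def]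
  exact D22.toLp.le_opNorm u

theorem D22.lintegral_rpow_le (u : D22 N) : ∫⁻ x, ‖u x‖ₑ ^ critExp N
    ≤ ENNReal.ofReal (‖D22.toLp (N := N)‖ * ‖u‖) ^ critExp N := by
  have h := u.eLpNorm_le
  rw [eLpNorm_eq_lintegral_rpow_enorm_toReal (by simpa using critExp_pos) (by simp),
    toReal_critExp, one_div] at h
  rwa [ENNReal.rpow_inv_le_iff critExp_pos] at h

theorem D22.measure_abs_ge_le (u : D22 N) {a : ℝ} (ha : 0 < a) : volume {x | a ≤ |u x|}
    ≤ (ENNReal.ofReal a)⁻¹ ^ critExp N *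
      ENNReal.ofReal (‖D22.toLp (N := N)‖ * ‖u‖) ^ critExp N := by
  have h := meas_ge_le_mul_pow_eLpNorm_enorm volume (p := ENNReal.ofReal (critExp N))
    (by simpa using critExp_pos) (by simp) u.aestronglyMeasurable
    (ε := ENNReal.ofReal a) (by simpa using ha) (by simp)
  have hset : {x | ENNReal.ofReal a ≤ ‖u x‖ₑ} = {x | a ≤ |u x|} := by
    ext x
    simp only [Set.mem_ofPred_eq, Real.enorm_eq_ofReal_abs]
    rw [ENNReal.ofReal_le_ofReal_iff (abs_nonneg _)]
  rw [hset, toReal_critExp] at h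
  refine h.trans ?_
  gcongr
  · exact critExp_pos.le
  · exact u.eLpNorm_le

theorem D22.measure_abs_ge_lt_top (u : D22 N) {a : ℝ} (ha : 0 < a) :
    volume {x | a ≤ |u x|} < ⊤ := by
  have hp := critExp_pos (N := N)
  refine (u.measure_abs_ge_le ha).trans_lt (ENNReal.mul_lt_top ?_ ?_)
  · exact ENNReal.rpow_lt_top_of_nonneg hp.le (by simpa using ha)
  · exact ENNReal.rpow_lt_top_of_nonneg hp.le (by simp)

/-- Chebyshev in `L^{2**}` and the Sobolev embedding. This makes the error of approximating by test
functions negligible in measure. -/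
theorem D22.tendsto_measure_of_norm {u : ℕ → D22 N} (hu : Tendsto (fun n => ‖u n‖) atTop (𝓝 0))
    {a : ℝ} (ha : 0 < a) : Tendsto (fun n => volume {x | a ≤ |u n x|}) atTop (𝓝 0) := by
  have hp := critExp_pos (N := N)
  refine tendsto_of_tendsto_of_tendsto_of_le_of_le tendsto_const_nhds ?_ (fun n => zero_le)
    (fun n => (u n).measure_abs_ge_le ha)
  have h1 : Tendsto (fun n => ENNReal.ofReal (‖D22.toLp (N := N)‖ * ‖u n‖) ^ critExp N) atTop
      (𝓝 0) := by
    have := (ENNReal.continuous_rpow_const (y := critExp N)).tendsto (ENNReal.ofReal 0)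
    rw [ENNReal.ofReal_zero, ENNReal.zero_rpow_of_pos hp] at this
    refine this.comp ?_
    rw [← ENNReal.ofReal_zero]
    exact (ENNReal.continuous_ofReal.tendsto 0).comp (by simpa using hu.const_mul _)
  simpa using ENNReal.Tendsto.const_mul h1
    (Or.inr (ENNReal.rpow_lt_top_of_nonneg hp.le (by simpa using ha)).ne)

theorem D22.nullMeasurableSet_abs_ge (u : D22 N) (a : ℝ) :
    NullMeasurableSet {x | a ≤ |u x|} volume :=
  nullMeasurableSet_le aemeasurable_const u.aestronglyMeasurable.norm.aemeasurable

/-- Integrates the splitting supplied by `IsSubcritical.abs_le`. With `ε = 1` it yields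
integrability, with `ε` arbitrary it yields convergence. -/
theorem IsSubcritical.lintegral_le {Ψ : ℝ → ℝ} {ε a K : ℝ} (hε : 0 ≤ ε)
    (h : ∀ s, |Ψ s| ≤ ε * |s| ^ critExp N + {s : ℝ | a ≤ |s|}.indicator (fun _ => K) s)
    (u : D22 N) :
    ∫⁻ x, ‖Ψ (u x)‖ₑ ≤ ENNReal.ofReal ε * ENNReal.ofReal (‖D22.toLp (N := N)‖ * ‖u‖) ^ critExp N +
      ENNReal.ofReal K * volume {x | a ≤ |u x|} := by
  have hp := critExp_pos (N := N)
  calc ∫⁻ x, ‖Ψ (u x)‖ₑ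
      ≤ ∫⁻ x, (ENNReal.ofReal ε * ‖u x‖ₑ ^ critExp N +
          {x | a ≤ |u x|}.indicator (fun _ => ENNReal.ofReal K) x) := by
        refine lintegral_mono fun x => ?_
        rw [Real.enorm_eq_ofReal_abs, Real.enorm_eq_ofReal_abs,
          ENNReal.ofReal_rpow_of_nonneg (abs_nonneg _) hp.le, ← ENNReal.ofReal_mul hε]
        refine (ENNReal.ofReal_le_ofReal (h (u x))).trans ?_
        refine ENNReal.ofReal_add_le.trans (add_le_add le_rfl ?_)
        by_cases hx : a ≤ |u x|
        · rw [Set.indicator_of_mem (show u x ∈ {s : ℝ | a ≤ |s|} from hx),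
            Set.indicator_of_mem (show x ∈ {x | a ≤ |u x|} from hx)]
        · rw [Set.indicator_of_notMem (show u x ∉ {s : ℝ | a ≤ |s|} from hx)]
          simp
    _ = ENNReal.ofReal ε * (∫⁻ x, ‖u x‖ₑ ^ critExp N)
          + ENNReal.ofReal K * volume {x | a ≤ |u x|} := by
        rw [lintegral_add_left' (((u.aestronglyMeasurable.enorm).pow_const _).const_mul _),
          lintegral_const_mul'' _ ((u.aestronglyMeasurable.enorm).pow_const _),
          lintegral_indicator_const₀ (u.nullMeasurableSet_abs_ge a)]
    _ ≤ _ := by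
        gcongr
        exact u.lintegral_rpow_le

theorem IsSubcritical.integrable {Ψ : ℝ → ℝ} (hΨ : IsSubcritical N Ψ) (u : D22 N) :
    Integrable (fun x => Ψ (u x)) volume := by
  refine ⟨hΨ.continuous.comp_aestronglyMeasurable u.aestronglyMeasurable, ?_⟩
  obtain ⟨a, ha, K, -, h⟩ := hΨ.abs_le one_pos
  refine (IsSubcritical.lintegral_le zero_le_one h u).trans_lt (ENNReal.add_lt_top.2 ⟨?_, ?_⟩)
  · exact ENNReal.mul_lt_top (by simp)
      (ENNReal.rpow_lt_top_of_nonneg critExp_pos.le (by simp))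
  · exact ENNReal.mul_lt_top (by simp) (u.measure_abs_ge_lt_top ha)

theorem IsSubcritical.tendsto_integral {Ψ : ℝ → ℝ} (hΨ : IsSubcritical N Ψ) {u : ℕ → D22 N}
    {C : ℝ} (hC : ∀ n, ‖u n‖ ≤ C)
    (hu : ∀ a : ℝ, 0 < a → Tendsto (fun n => volume {x | a ≤ |u n x|}) atTop (𝓝 0)) :
    Tendsto (fun n => ∫ x, Ψ (u n x)) atTop (𝓝 0) := by
  have hlim : Tendsto (fun n => ∫⁻ x, ‖Ψ (u n x)‖ₑ) atTop (𝓝 0) := by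
    refine tendsto_zero_of_le_add
      (C := ENNReal.ofReal (‖D22.toLp (N := N)‖ * C) ^ critExp N)
      (ENNReal.rpow_lt_top_of_nonneg critExp_pos.le (by simp)).ne fun ε hε => ?_
    obtain ⟨a, ha, K, -, h⟩ := hΨ.abs_le hε
    refine ⟨fun n => ENNReal.ofReal K * volume {x | a ≤ |u n x|}, ?_, fun n => ?_⟩
    · simpa using ENNReal.Tendsto.const_mul (hu a ha) (Or.inr ENNReal.ofReal_ne_top)
    · refine (IsSubcritical.lintegral_le hε.le h (u n)).trans ?_
      gcongr
      · exact critExp_pos.le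
      · exact hC n
  rw [tendsto_zero_iff_enorm_tendsto_zero]
  exact tendsto_of_tendsto_of_tendsto_of_le_of_le tendsto_const_nhds hlim (fun _ => zero_le)
    fun n => enorm_integral_le_lintegral_enorm _

/-- Only `min (|s| ^ (critExp N + 1)) 1` is tested. It is at least `m` on `{a ≤ |s|}`, so Chebyshev
applies to `Ψ(u n)` at level `m`. -/
theorem D22.tendsto_measure_of_integral {u : ℕ → D22 N}
    (hu : ∀ Ψ : ℝ → ℝ, IsSubcritical N Ψ → Tendsto (fun n => ∫ x, Ψ (u n x)) atTop (𝓝 0))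
    {a : ℝ} (ha : 0 < a) : Tendsto (fun n => volume {x | a ≤ |u n x|}) atTop (𝓝 0) := by
  set Ψ : ℝ → ℝ := fun s => min (|s| ^ (critExp N + 1)) 1 with hΨ
  have hsub : IsSubcritical N Ψ := isSubcritical_min N
  have hp := critExp_pos (N := N)
  set m : ℝ := min (a ^ (critExp N + 1)) 1
  have hm : 0 < m := by positivity
  have hle : ∀ n, volume {x | a ≤ |u n x|} ≤ ENNReal.ofReal (m⁻¹ * ∫ x, Ψ (u n x)) := by
    intro n
    have hint := hsub.integrable (u n)
    have hnn : ∀ x, 0 ≤ Ψ (u n x) := fun x => by simp only [hΨ]; positivity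
    have h := measure_inter_abs_ge_le hint.1 MeasurableSet.univ hm
    rw [Set.univ_inter, setLIntegral_univ] at h
    rw [ENNReal.ofReal_mul (by positivity), ENNReal.ofReal_inv_of_pos hm,
      ofReal_integral_eq_lintegral_ofReal hint (Eventually.of_forall hnn)]
    have henorm : ∀ x, ‖Ψ (u n x)‖ₑ = ENNReal.ofReal (Ψ (u n x)) := fun x => by
      rw [Real.enorm_eq_ofReal_abs, abs_of_nonneg (hnn x)]
    simp only [henorm] at h
    refine (measure_mono fun x hx => ?_).trans h
    change a ≤ |u n x| at hx
    change m ≤ |Ψ (u n x)|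
    rw [abs_of_nonneg (hnn x)]
    exact min_le_min (Real.rpow_le_rpow ha.le hx (by linarith)) le_rfl
  refine tendsto_of_tendsto_of_tendsto_of_le_of_le tendsto_const_nhds ?_ (fun n => zero_le) hle
  rw [← ENNReal.ofReal_zero]
  exact (ENNReal.continuous_ofReal.tendsto 0).comp (by simpa using (hu Ψ hsub).const_mul m⁻¹)

end Measure

/-! ### The Lions inequality: superlevel sets small on balls are small globally. -/

section Lions

variable {N : ℕ}

/-- The Sobolev exponent `2N / (N - 2)` of the gradient. -/
noncomputable def gradExp (N : ℕ) : ℝ≥0 := Real.toNNReal (2 * N / (N - 2))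

theorem coe_gradExp [h : Fact (5 ≤ N)] : (gradExp N : ℝ) = 2 * N / (N - 2) := by
  have h5 : (5 : ℝ) ≤ N := by exact_mod_cast h.out
  exact Real.coe_toNNReal _ (div_nonneg (by positivity) (by linarith))

theorem one_lt_gradExp [h : Fact (5 ≤ N)] : 1 < gradExp N := by
  have h5 : (5 : ℝ) ≤ N := by exact_mod_cast h.out
  rw [← NNReal.coe_lt_coe, coe_gradExp, NNReal.coe_one, lt_div_iff₀ (by linarith)]
  linarith

theorem one_div_gradExp_lt [Fact (5 ≤ N)] : 1 / (gradExp N : ℝ≥0∞).toReal < 1 := by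
  rw [ENNReal.coe_toReal, div_lt_one (by exact_mod_cast one_pos.trans one_lt_gradExp)]
  exact_mod_cast one_lt_gradExp

/-- The Gagliardo–Nirenberg–Sobolev inequality with exponent `2` for the vector-valued map `fderiv ℝ
f`. -/
theorem TestFun.eLpNorm_fderiv_le (N : ℕ) [h : Fact (5 ≤ N)] : ∃ C : ℝ≥0, ∀ f : TestFun N,
    eLpNorm (fderiv ℝ f) (gradExp N) volume ≤ C * ENNReal.ofReal ‖f‖ := by
  have h5 : (5 : ℝ) ≤ N := by exact_mod_cast h.out
  have hfin : Module.finrank ℝ (RN N) = N := by simp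
  have hq : (gradExp N : ℝ)⁻¹ = ((2 : ℝ≥0) : ℝ)⁻¹ - (Module.finrank ℝ (RN N) : ℝ)⁻¹ := by
    rw [hfin, coe_gradExp]
    change (2 * (N : ℝ) / (N - 2))⁻¹ = (2 : ℝ)⁻¹ - _
    have : (N : ℝ) - 2 ≠ 0 := by linarith
    field_simp
  have hpos : 0 < Module.finrank ℝ (RN N) := by rw [hfin]; linarith [h.out]
  let C₂ := SNormLESNormFDerivOfEqConst (RN N →L[ℝ] ℝ) (volume : Measure (RN N)) 2
  refine ⟨C₂ * (Fintype.card (Fin N × Fin N) : ℝ≥0), fun f => ?_⟩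
  have hD : ContDiff ℝ ∞ (fderiv ℝ f) := f.contDiff.fderiv_right (m := ∞) (by simp)
  have s2 : eLpNorm (fderiv ℝ f) (gradExp N) volume
      ≤ C₂ * eLpNorm (fderiv ℝ (fderiv ℝ f)) (2 : ℝ≥0) volume :=
    eLpNorm_le_eLpNorm_fderiv_of_eq volume (u := fderiv ℝ f) (hD.of_le (by norm_cast))
      (f.hasCompactSupport.fderiv (𝕜 := ℝ)) (by norm_num) hpos hq
  refine (s2.trans (mul_le_mul_right f.eLpNorm_fderiv_fderiv_le _)).trans_eq ?_
  push_cast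
  ring

theorem TestFun.continuous (f : TestFun N) : Continuous f := f.contDiff.continuous

theorem TestFun.continuous_fderiv (f : TestFun N) : Continuous (fderiv ℝ f) :=
  f.contDiff.continuous_fderiv (by simp)

/-- A `C¹` truncation which vanishes on `[-a, a]` and equals `1` outside `(-2a, 2a)`. -/
theorem exists_truncation {a : ℝ} (ha : 0 < a) : ∃ φ : ℝ → ℝ, ContDiff ℝ 1 φ ∧
    (∀ s, |s| ≤ a → φ s = 0) ∧ (∀ s, 2 * a ≤ |s| → φ s = 1) ∧ (∀ s, |φ s| ≤ 1) ∧
    ∃ M : ℝ≥0, ∀ s, ‖fderiv ℝ φ s‖₊ ≤ M := by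
  let b : ContDiffBump (0 : ℝ) := ⟨a, 2 * a, ha, by linarith⟩
  have hb : ContDiff ℝ 1 b := b.contDiff
  obtain ⟨M, hM⟩ := (b.hasCompactSupport.fderiv (𝕜 := ℝ)).exists_bound_of_continuous
    (hb.continuous_fderiv one_ne_zero)
  refine ⟨fun s => 1 - b s, contDiff_const.sub hb, fun s hs => ?_, fun s hs => ?_, fun s => ?_,
    ⟨M, (norm_nonneg _).trans (hM 0)⟩, fun s => ?_⟩
  · simp [b.one_of_mem_closedBall (x := s) (by simpa using hs)]
  · simp [b.zero_of_le_dist (x := s) (by simpa using hs)]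
  · rw [abs_le]
    constructor <;> linarith [b.nonneg (x := s), b.le_one (x := s)]
  · rw [fderiv_const_sub, nnnorm_neg]
    exact hM s

/-- The Sobolev inequality `L^{N/(N-1)}` by `‖∇·‖₁`, applied to `w` cut off near `y`, followed by
Hölder on the part of the ball where the product can be nonzero. The constants depend on `χ` alone,
not on the centre `y`, which permits averaging. -/
theorem lintegral_enorm_bump_mul_le [h : Fact (5 ≤ N)] (χ : ContDiffBump (0 : RN N)) :
    ∃ C M : ℝ≥0, ∀ (w : RN N → ℝ) (_ : ContDiff ℝ 1 w) (_ : HasCompactSupport w) (s : Set (RN N))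
      (_ : MeasurableSet s) (_ : ∀ x, x ∉ s → w x = 0) (y : RN N),
      ∫⁻ x, ‖χ (x - y) * w x‖ₑ ≤ C * volume (Metric.ball y χ.rOut ∩ s) ^ (1 / (N : ℝ)) *
        ∫⁻ x in Metric.closedBall y χ.rOut, (M * ‖w x‖ₑ + ‖fderiv ℝ w x‖ₑ) := by
  have h5 : (5 : ℝ) ≤ N := by exact_mod_cast h.out
  have hχ : ContDiff ℝ 1 χ := χ.contDiff
  obtain ⟨M, hM⟩ := (χ.hasCompactSupport.fderiv (𝕜 := ℝ)).exists_bound_of_continuous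
    (hχ.continuous_fderiv one_ne_zero)
  let M' : ℝ≥0 := ⟨M, (norm_nonneg _).trans (hM 0)⟩
  -- The Sobolev exponent of `1` is the Hölder conjugate of the dimension, so the Hölder gain `1 - 1
  -- / p` is exactly `1 / N`.
  let p : ℝ≥0 := Real.toNNReal (N / (N - 1))
  have hpr : (p : ℝ) = N / (N - 1) := Real.coe_toNNReal _ (div_nonneg (by positivity) (by linarith))
  have hp : NNReal.HolderConjugate (Module.finrank ℝ (RN N)) p := by
    rw [← NNReal.holderConjugate_coe_iff, hpr, Real.holderConjugate_iff]
    simp only [finrank_euclideanSpace, Fintype.card_fin, NNReal.coe_natCast]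
    refine ⟨by linarith, ?_⟩
    have : (N : ℝ) - 1 ≠ 0 := by linarith
    field_simp
    ring
  have hp1 : (1 : ℝ≥0∞) ≤ p := by
    rw [ENNReal.one_le_coe_iff, ← NNReal.coe_le_coe, hpr, NNReal.coe_one,
      le_div_iff₀ (by linarith)]
    linarith
  refine ⟨eLpNormLESNormFDerivOneConst (volume : Measure (RN N)) p, M',
    fun w hw hwc s hs hws y => ?_⟩
  set v : RN N → ℝ := fun x => χ (x - y) * w x with hv
  have hχy : ContDiff ℝ 1 fun x => χ (x - y) := hχ.comp (contDiff_id.sub contDiff_const)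
  have hvC : ContDiff ℝ 1 v := hχy.mul hw
  have hvc : HasCompactSupport v := hwc.mul_left
  have hsupp : ∀ x, x ∉ Metric.ball y χ.rOut ∩ s → v x = 0 := by
    intro x hx
    by_cases hxs : x ∈ s
    · have hxb : x ∉ Metric.ball y χ.rOut := fun hb => hx ⟨hb, hxs⟩
      rw [Metric.mem_ball, not_lt, dist_eq_norm] at hxb
      simp only [hv]
      rw [χ.zero_of_le_dist (by simpa using hxb), zero_mul]
    · simp only [hv]
      rw [hws x hxs, mul_zero]
  have h1 : ∫⁻ x, ‖v x‖ₑ = ∫⁻ x in Metric.ball y χ.rOut ∩ s, ‖v x‖ₑ := by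
    rw [← lintegral_indicator (Metric.isOpen_ball.measurableSet.inter hs)]
    congr 1
    funext x
    by_cases hx : x ∈ Metric.ball y χ.rOut ∩ s
    · rw [Set.indicator_of_mem hx]
    · rw [Set.indicator_of_notMem hx, hsupp x hx, enorm_zero]
  have hexp : 1 - 1 / (p : ℝ≥0∞).toReal = 1 / (N : ℝ) := by
    rw [ENNReal.coe_toReal, hpr]
    have : (N : ℝ) - 1 ≠ 0 := by linarith
    field_simp
    ring
  have h2 := setLIntegral_enorm_le (μ := volume) hvC.continuous.aestronglyMeasurable hp1
    (Metric.ball y χ.rOut ∩ s)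
  rw [hexp] at h2
  have h3 := eLpNorm_le_eLpNorm_fderiv_one (volume : Measure (RN N)) hvC hvc hp
  have h4 : eLpNorm (fderiv ℝ v) 1 volume
      ≤ ∫⁻ x in Metric.closedBall y χ.rOut, (M' * ‖w x‖ₑ + ‖fderiv ℝ w x‖ₑ) := by
    rw [eLpNorm_one_eq_lintegral_enorm, ← lintegral_indicator Metric.isClosed_closedBall.measurableSet]
    refine lintegral_mono fun x => ?_
    by_cases hx : x ∈ Metric.closedBall y χ.rOut
    · rw [Set.indicator_of_mem hx]
      have hd : fderiv ℝ v x = χ (x - y) • fderiv ℝ w x + w x • fderiv ℝ χ (x - y) := by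
        rw [hv, fderiv_fun_mul (hχy.differentiable one_ne_zero x) (hw.differentiable one_ne_zero x),
          fderiv_comp_sub]
      rw [hd, add_comm]
      have hadd : ∀ A B : RN N →L[ℝ] ℝ, ‖A + B‖ₑ ≤ ‖A‖ₑ + ‖B‖ₑ := fun A B => by
        simp only [enorm_eq_nnnorm]
        exact_mod_cast nnnorm_add_le A B
      refine (hadd _ _).trans (add_le_add ?_ ?_)
      · rw [enorm_smul, mul_comm]
        gcongr
        rw [enorm_eq_nnnorm, ENNReal.coe_le_coe]
        exact hM _
      · rw [enorm_smul]
        refine mul_le_of_le_one_left' ?_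
        rw [Real.enorm_eq_ofReal_abs, abs_of_nonneg χ.nonneg, ENNReal.ofReal_le_one]
        exact χ.le_one
    · rw [Set.indicator_of_notMem hx]
      -- The closed ball has open complement, so `v` vanishes near `x` and so does its derivative at
      -- `x`.
      have hz : v =ᶠ[𝓝 x] fun _ => 0 := by
        filter_upwards [Metric.isClosed_closedBall.isOpen_compl.mem_nhds hx] with z hz
        exact hsupp z fun hz' => hz (Metric.ball_subset_closedBall hz'.1)
      rw [hz.fderiv_eq, fderiv_const_apply, enorm_eq_nnnorm, nnnorm_zero, ENNReal.coe_zero]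
  calc ∫⁻ x, ‖v x‖ₑ ≤ eLpNorm v p volume * volume (Metric.ball y χ.rOut ∩ s) ^ (1 / (N : ℝ)) :=
        h1.trans_le h2
    _ ≤ _ := by
        rw [mul_right_comm]
        gcongr
        exact h3.trans (mul_le_mul_right h4 _)

/-- Averaging the local Sobolev inequality over all balls of a fixed radius. -/
theorem lintegral_enorm_le_of_measure_ball_le [Fact (5 ≤ N)] {r : ℝ} (hr : 0 < r) :
    ∃ K : ℝ≥0∞, K ≠ ⊤ ∧ ∀ (w : RN N → ℝ) (_ : ContDiff ℝ 1 w) (_ : HasCompactSupport w)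
      (s : Set (RN N)) (_ : MeasurableSet s) (_ : ∀ x, x ∉ s → w x = 0) (δ : ℝ≥0∞) (_ : δ ≠ ⊤)
      (_ : ∀ y, volume (Metric.ball y r ∩ s) ≤ δ),
      ∫⁻ x, ‖w x‖ₑ ≤ K * δ ^ (1 / (N : ℝ)) * ((∫⁻ x, ‖w x‖ₑ) + ∫⁻ x, ‖fderiv ℝ w x‖ₑ) := by
  let χ : ContDiffBump (0 : RN N) := ⟨r / 2, r, by linarith, by linarith⟩
  obtain ⟨C, M, hCM⟩ := lintegral_enorm_bump_mul_le χ
  set c₀ : ℝ≥0∞ := ∫⁻ y : RN N, ‖χ y‖ₑ with hc₀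
  have hc₀pos : c₀ ≠ 0 := by
    intro h0
    rw [hc₀, lintegral_eq_zero_iff' χ.continuous.enorm.aemeasurable] at h0
    have hnull : volume (Metric.ball (0 : RN N) (r / 2)) = 0 := by
      refine measure_mono_null (fun x hx => ?_) (ae_iff.1 h0)
      have h1 : χ x = 1 := χ.one_of_mem_closedBall (Metric.ball_subset_closedBall hx)
      simp [h1]
    exact (Metric.measure_ball_pos volume (0 : RN N) (by linarith : 0 < r / 2)).ne' hnull
  have hc₀top : c₀ ≠ ⊤ :=
    (χ.continuous.integrable_of_hasCompactSupport χ.hasCompactSupport).2.ne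
  set B : ℝ≥0∞ := volume (Metric.closedBall (0 : RN N) r)
  have hB : B ≠ ⊤ := measure_closedBall_lt_top.ne
  refine ⟨c₀⁻¹ * (C * B * (M + 1)), by finiteness, fun w hw hwc s hs hws δ hδt hδ => ?_⟩
  set G : RN N → ℝ≥0∞ := fun x => M * ‖w x‖ₑ + ‖fderiv ℝ w x‖ₑ
  have hG : Continuous G := ((ENNReal.continuous_const_mul (by simp)).comp hw.continuous.enorm).add
    (hw.continuous_fderiv one_ne_zero).enorm
  -- Tonelli: integrating the translated cutoff over all centres `y` gives the constant `c₀` at each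
  -- `x`.
  have hleft : ∫⁻ y, ∫⁻ x, ‖χ (x - y) * w x‖ₑ = (∫⁻ x, ‖w x‖ₑ) * c₀ := by
    rw [lintegral_lintegral_swap]
    · rw [← lintegral_mul_const _ hw.continuous.enorm.measurable]
      refine lintegral_congr fun x => ?_
      simp_rw [enorm_mul]
      rw [lintegral_mul_const' _ _ enorm_ne_top, mul_comm]
      congr 1
      exact lintegral_sub_left_eq_self (fun z => ‖χ z‖ₑ) x
    · refine Continuous.aemeasurable (Continuous.enorm ?_)
      exact (χ.continuous.comp (continuous_snd.sub continuous_fst)).mul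
        (hw.continuous.comp continuous_snd)
  -- Tonelli again: each `x` belongs to the balls whose centres fill a ball of measure `B` around
  -- `x`.
  have hright : ∫⁻ y, ∫⁻ x in Metric.closedBall y r, G x = B * ∫⁻ x, G x := by
    have hset : MeasurableSet {z : RN N × RN N | dist z.2 z.1 ≤ r} :=
      (isClosed_le (continuous_snd.dist continuous_fst) continuous_const).measurableSet
    have e1 : ∀ y : RN N, ∫⁻ x in Metric.closedBall y r, G x
        = ∫⁻ x, {z : RN N × RN N | dist z.2 z.1 ≤ r}.indicator (fun z => G z.2) (y, x) := by
      intro y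
      rw [← lintegral_indicator Metric.isClosed_closedBall.measurableSet]
      rfl
    simp_rw [e1]
    rw [lintegral_lintegral_swap]
    · rw [← lintegral_const_mul _ hG.measurable]
      refine lintegral_congr fun x => ?_
      have e2 : ∀ y : RN N, {z : RN N × RN N | dist z.2 z.1 ≤ r}.indicator (fun z => G z.2) (y, x)
          = (Metric.closedBall x r).indicator (fun _ => G x) y := by
        intro y
        simp only [Set.indicator, Set.mem_ofPred_eq, Metric.mem_closedBall, dist_comm]
      simp_rw [e2]
      rw [lintegral_indicator_const Metric.isClosed_closedBall.measurableSet,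
        Measure.addHaar_closedBall_center, mul_comm]
    · exact ((hG.comp continuous_snd).measurable.indicator hset).aemeasurable
  have hmain : (∫⁻ x, ‖w x‖ₑ) * c₀ ≤ C * δ ^ (1 / (N : ℝ)) * (B * ∫⁻ x, G x) := by
    rw [← hleft, ← hright, ← lintegral_const_mul']
    · refine lintegral_mono fun y => (hCM w hw hwc s hs hws y).trans ?_
      gcongr
      exact hδ y
    · exact ENNReal.mul_ne_top (by simp) (ENNReal.rpow_ne_top_of_nonneg (by positivity) hδt)
  have hGle : ∫⁻ x, G x ≤ (M + 1) * ((∫⁻ x, ‖w x‖ₑ) + ∫⁻ x, ‖fderiv ℝ w x‖ₑ) := by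
    rw [lintegral_add_right _ (hw.continuous_fderiv one_ne_zero).enorm.measurable,
      lintegral_const_mul _ hw.continuous.enorm.measurable, mul_add]
    gcongr
    · exact le_self_add
    · exact le_mul_of_one_le_left' le_add_self
  calc ∫⁻ x, ‖w x‖ₑ = c₀⁻¹ * ((∫⁻ x, ‖w x‖ₑ) * c₀) := by
        rw [mul_comm (∫⁻ x, ‖w x‖ₑ), ← mul_assoc, ENNReal.inv_mul_cancel hc₀pos hc₀top, one_mul]
    _ ≤ c₀⁻¹ * (C * δ ^ (1 / (N : ℝ)) *
          (B * ((M + 1) * ((∫⁻ x, ‖w x‖ₑ) + ∫⁻ x, ‖fderiv ℝ w x‖ₑ)))) := by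
        exact mul_le_mul_right (hmain.trans (by gcongr)) _
    _ = _ := by ring

/-- The averaged inequality is applied to the truncation `w = φ ∘ f`. It equals `1` where `|f| ≥
2a`, while `w` and `∇w` vanish where `|f| < a`, so Hölder on `{a ≤ |f|}` bounds `‖∇w‖₁` through the
gradient norm of `f`. -/
theorem TestFun.measure_abs_ge_le_of_measure_ball_le [Fact (5 ≤ N)] {a r : ℝ} (ha : 0 < a)
    (hr : 0 < r) : ∃ K : ℝ≥0∞, K ≠ ⊤ ∧ ∀ (f : TestFun N) (δ : ℝ≥0∞) (_ : δ ≠ ⊤)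
      (_ : ∀ y, volume (Metric.ball y r ∩ {x | a ≤ |f x|}) ≤ δ),
      volume {x | 2 * a ≤ |f x|} ≤ K * δ ^ (1 / (N : ℝ)) * (volume {x | a ≤ |f x|} +
        ENNReal.ofReal ‖f‖ * volume {x | a ≤ |f x|} ^ (1 - 1 / (gradExp N : ℝ≥0∞).toReal)) := by
  obtain ⟨φ, hφ, hφ0, hφ1, hφle, M, hM⟩ := exists_truncation ha
  obtain ⟨K, hK, hKw⟩ := lintegral_enorm_le_of_measure_ball_le (N := N) hr
  obtain ⟨C, hC⟩ := TestFun.eLpNorm_fderiv_le N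
  refine ⟨K * (1 + M * C), by finiteness, fun f δ hδt hδ => ?_⟩
  set s : Set (RN N) := {x | a ≤ |f x|} with hs_def
  have hs : MeasurableSet s := (isClosed_le continuous_const f.continuous.abs).measurableSet
  set w : RN N → ℝ := φ ∘ f with hw_def
  have hw : ContDiff ℝ 1 w := hφ.comp (f.contDiff.of_le (by norm_cast))
  have hwc : HasCompactSupport w := f.hasCompactSupport.comp_left (hφ0 0 (by simpa using ha.le))
  have hws : ∀ x, x ∉ s → w x = 0 := fun x hx => hφ0 _ (not_le.1 hx).le
  have h1 : volume {x | 2 * a ≤ |f x|} ≤ ∫⁻ x, ‖w x‖ₑ := by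
    have h := mul_meas_ge_le_lintegral (μ := (volume : Measure (RN N)))
      hw.continuous.enorm.measurable 1
    rw [one_mul] at h
    refine (measure_mono fun x hx => ?_).trans h
    change 1 ≤ ‖φ (f x)‖ₑ
    rw [hφ1 _ hx]
    simp
  have h2 : ∫⁻ x, ‖w x‖ₑ ≤ volume s := by
    rw [← lintegral_indicator_one hs]
    refine lintegral_mono fun x => ?_
    by_cases hx : x ∈ s
    · rw [Set.indicator_of_mem hx, Real.enorm_eq_ofReal_abs, Pi.one_apply, ENNReal.ofReal_le_one]
      exact hφle _
    · rw [Set.indicator_of_notMem hx, hws x hx, enorm_zero]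
  have h3 : ∫⁻ x, ‖fderiv ℝ w x‖ₑ ≤ M * ∫⁻ x in s, ‖fderiv ℝ f x‖ₑ := by
    rw [← lintegral_const_mul _ f.continuous_fderiv.enorm.measurable, ← lintegral_indicator hs]
    refine lintegral_mono fun x => ?_
    by_cases hx : x ∈ s
    · rw [Set.indicator_of_mem hx, hw_def, fderiv_comp x (hφ.differentiable one_ne_zero _)
        (f.contDiff.differentiable (by simp) x), enorm_eq_nnnorm, enorm_eq_nnnorm,
        ← ENNReal.coe_mul, ENNReal.coe_le_coe]
      refine (ContinuousLinearMap.opNNNorm_comp_le _ _).trans ?_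
      gcongr
      exact hM _
    · rw [Set.indicator_of_notMem hx]
      have hz : w =ᶠ[𝓝 x] fun _ => 0 := by
        have hopen : IsOpen {x | |f x| < a} := isOpen_lt f.continuous.abs continuous_const
        filter_upwards [hopen.mem_nhds (show |f x| < a from not_le.1 hx)] with z hz
        exact hφ0 _ (le_of_lt hz)
      rw [hz.fderiv_eq, fderiv_const_apply, enorm_eq_nnnorm, nnnorm_zero, ENNReal.coe_zero]
  have h4 := setLIntegral_enorm_le (μ := volume) f.continuous_fderiv.aestronglyMeasurable
    (p := gradExp N) (by exact_mod_cast one_lt_gradExp.le) s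
  set V := volume s ^ (1 - 1 / (gradExp N : ℝ≥0∞).toReal)
  calc volume {x | 2 * a ≤ |f x|} ≤ ∫⁻ x, ‖w x‖ₑ := h1
    _ ≤ K * δ ^ (1 / (N : ℝ)) * ((∫⁻ x, ‖w x‖ₑ) + ∫⁻ x, ‖fderiv ℝ w x‖ₑ) :=
        hKw w hw hwc s hs hws δ hδt hδ
    _ ≤ K * δ ^ (1 / (N : ℝ)) * (volume s + M * (C * ENNReal.ofReal ‖f‖ * V)) := by
        gcongr
        exact h3.trans (by gcongr; exact h4.trans (by gcongr; exact hC f))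
    _ ≤ K * δ ^ (1 / (N : ℝ)) * ((1 + M * C) * (volume s + ENNReal.ofReal ‖f‖ * V)) := by
        gcongr
        calc volume s + M * (C * ENNReal.ofReal ‖f‖ * V)
            = 1 * volume s + (M * C) * (ENNReal.ofReal ‖f‖ * V) := by ring
          _ ≤ (1 + M * C) * volume s + (1 + M * C) * (ENNReal.ofReal ‖f‖ * V) := by
              gcongr
              · exact le_self_add
              · exact le_add_self
          _ = _ := by ring
    _ = _ := by ring

end Lions

/-! ### Approximation by test functions and the Lions lemma in measure. -/

section Sequences

variable {N : ℕ}

/-- Derivatives and pointwise values are available only for test functions; this replaces a sequence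
by test functions at a cost vanishing in norm, hence in measure. -/
theorem D22.exists_testFun_approx (u : ℕ → D22 N) : ∃ f : ℕ → TestFun N,
    (∀ n, ‖u n - (f n : D22 N)‖ ≤ 1) ∧
      Tendsto (fun n => ‖u n - (f n : D22 N)‖) atTop (𝓝 0) := by
  have h : ∀ n : ℕ, ∃ f : TestFun N, ‖u n - (f : D22 N)‖ < 1 / ((n : ℝ) + 1) := fun n => by
    obtain ⟨f, hf⟩ := (UniformSpace.Completion.denseRange_coe (α := TestFun N)).exists_dist_lt
      (u n) (Nat.one_div_pos_of_nat (α := ℝ) (n := n))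
    exact ⟨f, by rwa [dist_eq_norm] at hf⟩
  choose f hf using h
  refine ⟨f, fun n => (hf n).le.trans ?_, squeeze_zero (fun n => norm_nonneg _)
    (fun n => (hf n).le) tendsto_one_div_add_atTop_nhds_zero_nat⟩
  rw [div_le_one (by positivity)]
  linarith [Nat.cast_nonneg (α := ℝ) n]

theorem D22.norm_testFun_le {u : D22 N} {f : TestFun N} {C : ℝ} (hu : ‖u‖ ≤ C)
    (h : ‖u - (f : D22 N)‖ ≤ 1) : ‖f‖ ≤ C + 1 := by
  rw [← UniformSpace.Completion.norm_coe]
  have := norm_sub_norm_le (f : D22 N) u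
  rw [norm_sub_rev] at this
  linarith

variable [Fact (5 ≤ N)]

theorem D22.sub_testFun_ae_eq (u : D22 N) (f : TestFun N) :
    ((u - (f : D22 N) : D22 N) : RN N → ℝ) =ᵐ[volume] fun x => u x - f x := by
  filter_upwards [D22.sub_ae_eq u f, D22.coe_ae_eq f] with x h1 h2
  rw [h1, h2]

theorem D22.measure_inter_abs_ge_le_testFun (u : D22 N) (f : TestFun N) (s : Set (RN N)) (a : ℝ) :
    volume (s ∩ {x | a ≤ |u x|}) ≤ volume (s ∩ {x | a / 2 ≤ |f x|}) +
      volume {x | a / 2 ≤ |(u - (f : D22 N) : D22 N) x|} :=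
  (measure_inter_abs_ge_le_add (D22.sub_testFun_ae_eq u f) s a).trans
    (add_le_add le_rfl (measure_mono Set.inter_subset_right))

theorem TestFun.measure_inter_abs_ge_le (u : D22 N) (f : TestFun N) (s : Set (RN N)) (a : ℝ) :
    volume (s ∩ {x | a ≤ |f x|}) ≤ volume (s ∩ {x | a / 2 ≤ |u x|}) +
      volume {x | a / 2 ≤ |(u - (f : D22 N) : D22 N) x|} := by
  have h := measure_inter_abs_ge_le_add (f := f) (g := u)
    (d := fun x => -((u - (f : D22 N) : D22 N) x)) (μ := volume) (by
      filter_upwards [D22.sub_testFun_ae_eq u f] with x hx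
      rw [hx]
      ring) s a
  simp only [abs_neg] at h
  exact h.trans (add_le_add le_rfl (measure_mono Set.inter_subset_right))

theorem D22.measure_abs_ge_le_testFun (u : D22 N) (f : TestFun N) (a : ℝ) :
    volume {x | a ≤ |u x|} ≤ volume {x | a / 2 ≤ |f x|} +
      volume {x | a / 2 ≤ |(u - (f : D22 N) : D22 N) x|} := by
  simpa using D22.measure_inter_abs_ge_le_testFun u f Set.univ a

theorem TestFun.measure_abs_ge_le (u : D22 N) (f : TestFun N) (a : ℝ) :
    volume {x | a ≤ |f x|} ≤ volume {x | a / 2 ≤ |u x|} +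
      volume {x | a / 2 ≤ |(u - (f : D22 N) : D22 N) x|} := by
  simpa using TestFun.measure_inter_abs_ge_le u f Set.univ a

theorem TestFun.measure_abs_ge_le_norm (f : TestFun N) {a : ℝ} (ha : 0 < a) :
    volume {x | a ≤ |f x|} ≤ (ENNReal.ofReal a)⁻¹ ^ critExp N *
      ENNReal.ofReal (‖D22.toLp (N := N)‖ * ‖f‖) ^ critExp N := by
  have h := D22.measure_abs_ge_le (f : D22 N) ha
  rw [UniformSpace.Completion.norm_coe] at h
  refine (measure_mono_ae ?_).trans h
  filter_upwards [D22.coe_ae_eq f] with x hx hxa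
  change a ≤ |((f : D22 N) : RN N → ℝ) x|
  rw [hx]
  exact hxa

/-- Lions' lemma in terms of convergence in measure: a bounded sequence whose superlevel sets
vanish uniformly on balls of a fixed radius converges to `0` in measure. -/
theorem D22.tendsto_measure_of_tendsto_iSup_ball {u : ℕ → D22 N} {C : ℝ} (hC : ∀ n, ‖u n‖ ≤ C)
    {r : ℝ} (hr : 0 < r)
    (h : ∀ a : ℝ, 0 < a → Tendsto
      (fun n => ⨆ y : RN N, volume (Metric.ball y r ∩ {x | a ≤ |u n x|})) atTop (𝓝 0))
    {a : ℝ} (ha : 0 < a) : Tendsto (fun n => volume {x | a ≤ |u n x|}) atTop (𝓝 0) := by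
  obtain ⟨f, hf1, hf0⟩ := D22.exists_testFun_approx u
  have hd : ∀ b : ℝ, 0 < b →
      Tendsto (fun n => volume {x | b ≤ |(u n - (f n : D22 N) : D22 N) x|}) atTop (𝓝 0) :=
    fun b hb => D22.tendsto_measure_of_norm hf0 hb
  -- One halving pays for replacing `u n` by `f n`, the other for the truncation. A third occurs in
  -- `hδ`, on returning from `f n` to `u n`.
  have ha4 : 0 < a / 2 / 2 := by positivity
  obtain ⟨K, hK, hKf⟩ := TestFun.measure_abs_ge_le_of_measure_ball_le (N := N) ha4 hr
  set δ : ℕ → ℝ≥0∞ := fun n => ⨆ y : RN N, volume (Metric.ball y r ∩ {x | a / 2 / 2 ≤ |f n x|})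
  have hδtop : ∀ n, δ n ≠ ⊤ := fun n => by
    refine ((iSup_le fun y => ?_).trans_lt
      (measure_ball_lt_top (μ := volume) (x := (0 : RN N)) (r := r))).ne
    rw [← Measure.addHaar_ball_center volume y r]
    exact measure_mono Set.inter_subset_left
  have hδ : Tendsto δ atTop (𝓝 0) := by
    have hsum := (h _ (half_pos ha4)).add (hd _ (half_pos ha4))
    rw [add_zero] at hsum
    refine tendsto_of_tendsto_of_tendsto_of_le_of_le tendsto_const_nhds hsum (fun n => zero_le)
      fun n => ?_
    refine iSup_le fun y => (TestFun.measure_inter_abs_ge_le (u n) (f n) _ _).trans ?_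
    refine add_le_add ?_ le_rfl
    exact le_iSup (fun y => volume (Metric.ball y r ∩ {x | a / 2 / 2 / 2 ≤ |u n x|})) y
  set V : ℝ≥0∞ := (ENNReal.ofReal (a / 2 / 2))⁻¹ ^ critExp N *
      ENNReal.ofReal (‖D22.toLp (N := N)‖ * (C + 1)) ^ critExp N
  have hVtop : V ≠ ⊤ := ENNReal.mul_ne_top
    (ENNReal.rpow_ne_top_of_nonneg critExp_pos.le (by simpa using ha))
    (ENNReal.rpow_ne_top_of_nonneg critExp_pos.le (by simp))
  have hV : ∀ n, volume {x | a / 2 / 2 ≤ |f n x|} ≤ V := fun n => by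
    refine ((f n).measure_abs_ge_le_norm ha4).trans (mul_le_mul_right ?_ _)
    gcongr
    · exact critExp_pos.le
    · exact D22.norm_testFun_le (hC n) (hf1 n)
  have hexp : 0 ≤ 1 - 1 / (gradExp N : ℝ≥0∞).toReal := by linarith [one_div_gradExp_lt (N := N)]
  set D : ℝ≥0∞ := V + ENNReal.ofReal (C + 1) * V ^ (1 - 1 / (gradExp N : ℝ≥0∞).toReal)
  have hD : D ≠ ⊤ := ENNReal.add_ne_top.2 ⟨hVtop, ENNReal.mul_ne_top ENNReal.ofReal_ne_top
    (ENNReal.rpow_ne_top_of_nonneg hexp hVtop)⟩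
  have hfn : ∀ n, volume {x | a / 2 ≤ |f n x|} ≤ K * δ n ^ (1 / (N : ℝ)) * D := fun n => by
    have h1 := hKf (f n) (δ n) (hδtop n)
      (fun y => le_iSup (fun y => volume (Metric.ball y r ∩ {x | a / 2 / 2 ≤ |f n x|})) y)
    rw [show 2 * (a / 2 / 2) = a / 2 by ring] at h1
    refine h1.trans (mul_le_mul_right (add_le_add (hV n) ?_) _)
    exact mul_le_mul' (ENNReal.ofReal_le_ofReal (D22.norm_testFun_le (hC n) (hf1 n)))
      (ENNReal.rpow_le_rpow (hV n) hexp)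
  have hNpos : 0 < 1 / (N : ℝ) := by
    have : 5 ≤ N := Fact.out
    have : (5 : ℝ) ≤ N := by exact_mod_cast this
    positivity
  have hlim : Tendsto (fun n => K * δ n ^ (1 / (N : ℝ)) * D) atTop (𝓝 0) := by
    have h1 : Tendsto (fun n => δ n ^ (1 / (N : ℝ))) atTop (𝓝 0) := by
      have := ((ENNReal.continuous_rpow_const (y := 1 / (N : ℝ))).tendsto 0).comp hδ
      rwa [ENNReal.zero_rpow_of_pos hNpos] at this
    simpa using ENNReal.Tendsto.mul_const (ENNReal.Tendsto.const_mul h1 (Or.inr hK)) (Or.inr hD)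
  have hsum := hlim.add (hd _ (half_pos ha))
  rw [add_zero] at hsum
  refine tendsto_of_tendsto_of_tendsto_of_le_of_le tendsto_const_nhds hsum
    (fun n => zero_le) fun n => ?_
  exact (D22.measure_abs_ge_le_testFun (u n) (f n) a).trans (add_le_add (hfn n) le_rfl)

end Sequences

/-! ### From convergence in measure to weak convergence. -/

section Weak

variable {N : ℕ}

theorem integral_partialD_mul {f g : RN N → ℝ} (hf : ContDiff ℝ ∞ f) (hfc : HasCompactSupport f)
    (hg : ContDiff ℝ ∞ g) (i : Fin N) :
    ∫ x, partialD i f x * g x = ∫ x, f x * -partialD i g x := by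
  have h := integral_mul_fderiv_eq_neg_fderiv_mul_of_integrable (μ := (volume : Measure (RN N)))
    (f := f) (g := g) (v := EuclideanSpace.single i 1)
    (((contDiff_partialD hf i).continuous.mul hg.continuous).integrable_of_hasCompactSupport
      (hasCompactSupport_partialD hfc i).mul_right)
    ((hf.continuous.mul (contDiff_partialD hg i).continuous).integrable_of_hasCompactSupport
      hfc.mul_right)
    ((hf.continuous.mul hg.continuous).integrable_of_hasCompactSupport hfc.mul_right)
    (fun x _ => hf.differentiable (by simp) x) (fun x _ => hg.differentiable (by simp) x)
  simp only [mul_neg, integral_neg]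
  change _ = -∫ x, f x * fderiv ℝ g x (EuclideanSpace.single i 1)
  rw [h, neg_neg]
  rfl

/-- The inner product with a fixed test function is the integral against a continuous compactly
supported function. -/
theorem TestFun.exists_inner_eq_integral (g : TestFun N) : ∃ h : RN N → ℝ, Continuous h ∧
    HasCompactSupport h ∧ ∀ f : TestFun N, inner ℝ f g = ∫ x, f x * h x := by
  have hg2 : ∀ p, ContDiff ℝ ∞ (g.d2 p) := fun p =>
    contDiff_partialD (contDiff_partialD g.contDiff _) _
  -- Two integrations by parts move first `∂_{p.1}`, then `∂_{p.2}`, from `f` onto `g.d2 p`; the two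
  -- signs cancel.
  let k : Fin N × Fin N → RN N → ℝ := fun p => partialD p.2 (partialD p.1 (g.d2 p))
  have hk : ∀ p, ContDiff ℝ ∞ (k p) := fun p =>
    contDiff_partialD (contDiff_partialD (hg2 p) _) _
  have hkc : ∀ p, HasCompactSupport (k p) := fun p =>
    hasCompactSupport_partialD (hasCompactSupport_partialD (g.hasCompactSupport_d2 p) _) _
  refine ⟨fun x => ∑ p ∈ idx2 N, k p x, continuous_finsetSum _ fun p _ => (hk p).continuous,
    ?_, fun f => ?_⟩
  · have hsum : ∀ s : Finset (Fin N × Fin N), HasCompactSupport fun x => ∑ p ∈ s, k p x := by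
      intro s
      induction s using Finset.induction_on with
      | empty => exact HasCompactSupport.zero
      | insert p s hp ih =>
        simp only [Finset.sum_insert hp]
        exact (hkc p).add ih
    exact hsum _
  · change ∑ p ∈ idx2 N, ∫ x, f.d2 p x * g.d2 p x = _
    simp_rw [Finset.mul_sum]
    have hint : ∀ p ∈ idx2 N, Integrable fun x => f x * k p x := fun p _ =>
      (f.continuous.mul (hk p).continuous).integrable_of_hasCompactSupport
        f.hasCompactSupport.mul_right
    rw [integral_finsetSum _ hint]
    refine Finset.sum_congr rfl fun p _ => ?_
    change ∫ x, partialD p.1 (partialD p.2 f) x * g.d2 p x = _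
    rw [integral_partialD_mul (contDiff_partialD f.contDiff _)
      (hasCompactSupport_partialD f.hasCompactSupport _) (hg2 p)]
    simp only [mul_neg, integral_neg]
    rw [integral_partialD_mul f.contDiff f.hasCompactSupport (contDiff_partialD (hg2 p) _)]
    simp only [mul_neg, integral_neg, neg_neg]
    rfl

theorem D22.tendsto_toWeakSpace_iff {u : ℕ → D22 N} :
    Tendsto (fun n => toWeakSpace ℝ (D22 N) (u n)) atTop (𝓝 0) ↔
      ∀ φ : D22 N →L[ℝ] ℝ, Tendsto (fun n => φ (u n)) atTop (𝓝 0) := by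
  have hinj : Function.Injective (topDualPairing ℝ (D22 N)).flip := by
    intro x y hxy
    refine (SeparatingDual.eq_iff_forall_dual_eq (R := ℝ)).2 fun g => ?_
    exact LinearMap.congr_fun hxy g
  refine (WeakBilin.tendsto_iff_forall_eval_tendsto (topDualPairing ℝ (D22 N)).flip hinj).trans ?_
  have h0 : ∀ φ : D22 N →L[ℝ] ℝ, (topDualPairing ℝ (D22 N)).flip 0 φ = 0 := fun φ => map_zero φ
  exact forall_congr' fun φ => by rw [← h0 φ]; rfl

variable [Fact (5 ≤ N)]

/-- Split at `|f n| = ε`. Below this level the integral is at most `ε ‖h‖₁`; above it `h` is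
bounded, and Hölder with the exponent `2** > 1` leaves a positive power of the vanishing measure. -/
theorem TestFun.tendsto_integral_mul {f : ℕ → TestFun N} {C : ℝ} (hC : ∀ n, ‖f n‖ ≤ C)
    (hf : ∀ a : ℝ, 0 < a → Tendsto (fun n => volume {x | a ≤ |f n x|}) atTop (𝓝 0))
    {h : RN N → ℝ} (hh : Continuous h) (hhc : HasCompactSupport h) :
    Tendsto (fun n => ∫ x, f n x * h x) atTop (𝓝 0) := by
  obtain ⟨S, hS⟩ := TestFun.sobolev N
  obtain ⟨M, hM⟩ := hhc.exists_bound_of_continuous hh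
  have hθ : 0 < 1 - 1 / (ENNReal.ofReal (critExp N)).toReal := by
    rw [toReal_critExp, sub_pos, div_lt_one critExp_pos]
    exact one_lt_critExp
  have hlim : Tendsto (fun n => ∫⁻ x, ‖f n x * h x‖ₑ) atTop (𝓝 0) := by
    refine tendsto_zero_of_le_add (C := ∫⁻ x, ‖h x‖ₑ)
      (hh.integrable_of_hasCompactSupport hhc).2.ne fun ε hε => ?_
    refine ⟨fun n => ENNReal.ofReal M * (S * ENNReal.ofReal C *
      volume {x | ε ≤ |f n x|} ^ (1 - 1 / (ENNReal.ofReal (critExp N)).toReal)), ?_, fun n => ?_⟩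
    · have h1 := ((ENNReal.continuous_rpow_const
        (y := 1 - 1 / (ENNReal.ofReal (critExp N)).toReal)).tendsto 0).comp (hf ε hε)
      rw [ENNReal.zero_rpow_of_pos hθ] at h1
      simpa using ENNReal.Tendsto.const_mul (ENNReal.Tendsto.const_mul h1
        (Or.inr (ENNReal.mul_ne_top ENNReal.coe_ne_top ENNReal.ofReal_ne_top)))
        (Or.inr ENNReal.ofReal_ne_top)
    · set s : Set (RN N) := {x | ε ≤ |f n x|}
      have hs : MeasurableSet s := (isClosed_le continuous_const (f n).continuous.abs).measurableSet
      have h2 := setLIntegral_enorm_le (μ := volume) (f n).continuous.aestronglyMeasurable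
        (p := ENNReal.ofReal (critExp N)) Fact.out s
      calc ∫⁻ x, ‖f n x * h x‖ₑ
          ≤ ∫⁻ x, (ENNReal.ofReal ε * ‖h x‖ₑ +
              s.indicator (fun x => ENNReal.ofReal M * ‖f n x‖ₑ) x) := by
            refine lintegral_mono fun x => ?_
            rw [enorm_mul]
            by_cases hx : x ∈ s
            · rw [Set.indicator_of_mem hx, mul_comm]
              refine le_add_left ?_
              gcongr
              rw [Real.enorm_eq_ofReal_abs]
              exact ENNReal.ofReal_le_ofReal (hM x)
            · rw [Set.indicator_of_notMem hx, add_zero]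
              gcongr
              rw [Real.enorm_eq_ofReal_abs]
              exact ENNReal.ofReal_le_ofReal (not_le.1 hx).le
        _ = ENNReal.ofReal ε * (∫⁻ x, ‖h x‖ₑ) + ENNReal.ofReal M * ∫⁻ x in s, ‖f n x‖ₑ := by
            rw [lintegral_add_left (hh.enorm.measurable.const_mul _),
              lintegral_const_mul _ hh.enorm.measurable, lintegral_indicator hs,
              lintegral_const_mul _ (f n).continuous.enorm.measurable]
        _ ≤ _ := by
            refine add_le_add le_rfl (mul_le_mul_right (h2.trans (mul_le_mul_left ?_ _)) _)
            exact (hS (f n)).trans (by gcongr; exact hC n)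
  rw [tendsto_zero_iff_enorm_tendsto_zero]
  exact tendsto_of_tendsto_of_tendsto_of_le_of_le tendsto_const_nhds hlim (fun _ => zero_le)
    fun n => enorm_integral_le_lintegral_enorm _

/-- A bounded sequence of `𝓓^{2,2}` which converges to `0` in measure converges weakly to `0`. -/
theorem D22.tendsto_toWeakSpace_of_tendsto_measure {u : ℕ → D22 N} {C : ℝ}
    (hC : ∀ n, ‖u n‖ ≤ C)
    (hu : ∀ a : ℝ, 0 < a → Tendsto (fun n => volume {x | a ≤ |u n x|}) atTop (𝓝 0)) :
    Tendsto (fun n => toWeakSpace ℝ (D22 N) (u n)) atTop (𝓝 0) := by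
  rw [D22.tendsto_toWeakSpace_iff]
  intro φ
  obtain ⟨f, hf1, hf0⟩ := D22.exists_testFun_approx u
  have hfC : ∀ n, ‖f n‖ ≤ C + 1 := fun n => D22.norm_testFun_le (hC n) (hf1 n)
  have hfm : ∀ a : ℝ, 0 < a → Tendsto (fun n => volume {x | a ≤ |f n x|}) atTop (𝓝 0) := by
    intro a ha
    refine tendsto_of_tendsto_of_tendsto_of_le_of_le tendsto_const_nhds
      (by simpa using (hu _ (half_pos ha)).add (D22.tendsto_measure_of_norm hf0 (half_pos ha)))
      (fun n => zero_le) fun n => TestFun.measure_abs_ge_le (u n) (f n) a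
  set v : D22 N := (InnerProductSpace.toDual ℝ (D22 N)).symm φ
  have hv : ∀ w, φ w = inner ℝ v w := fun w => by
    rw [InnerProductSpace.toDual_symm_apply]
  have hf : Tendsto (fun n => φ (f n : D22 N)) atTop (𝓝 0) := by
    rw [Metric.tendsto_atTop]
    intro ε hε
    have hC0 : 0 < C + 1 + 1 := by linarith [(norm_nonneg _).trans (hfC 0)]
    -- `C + 1` bounds `‖f n‖`; the further `+ 1` makes the divisor positive.
    obtain ⟨g, hg⟩ := (UniformSpace.Completion.denseRange_coe (α := TestFun N)).exists_dist_lt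
      v (ε := ε / 2 / (C + 1 + 1)) (by positivity)
    obtain ⟨h, hh, hhc, hfh⟩ := g.exists_inner_eq_integral
    have hlim := TestFun.tendsto_integral_mul hfC hfm hh hhc
    obtain ⟨n₀, hn₀⟩ := Metric.tendsto_atTop.1 hlim (ε / 2) (by positivity)
    refine ⟨n₀, fun n hn => ?_⟩
    have h1 := hn₀ n hn
    rw [← hfh, dist_zero_right, Real.norm_eq_abs] at h1
    rw [dist_zero_right, Real.norm_eq_abs, hv]
    have h2 : inner ℝ v (f n : D22 N) = inner ℝ (v - (g : D22 N)) (f n : D22 N) + inner ℝ (f n) g := by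
      rw [inner_sub_left, UniformSpace.Completion.inner_coe, real_inner_comm (f n) g]
      ring
    rw [dist_eq_norm] at hg
    have h3 : |inner ℝ (v - (g : D22 N)) (f n : D22 N)| ≤ ε / 2 := by
      refine (abs_real_inner_le_norm _ _).trans ?_
      rw [UniformSpace.Completion.norm_coe]
      calc _ ≤ ε / 2 / (C + 1 + 1) * (C + 1 + 1) := by
            gcongr
            linarith [hfC n]
        _ = ε / 2 := by field_simp
    rw [h2]
    linarith [abs_add_le (inner ℝ (v - (g : D22 N)) (f n : D22 N)) (inner ℝ (f n) g)]
  have hsub : Tendsto (fun n => φ (u n - (f n : D22 N))) atTop (𝓝 0) := by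
    have := (φ.continuous.tendsto 0).comp (tendsto_zero_iff_norm_tendsto_zero.2 hf0)
    rwa [map_zero] at this
  simpa using hsub.add hf

end Weak

/-! ### Local compactness: weak convergence gives convergence in measure on balls. -/

section Compactness

variable {N : ℕ}

theorem TestFun.enorm_sub_le (f : TestFun N) (x z : RN N) :
    ‖f (x + z) - f x‖ₑ ≤ ‖z‖ₑ * ∫⁻ t in Set.Ioc (0 : ℝ) 1, ‖fderiv ℝ f (x + t • z)‖ₑ := by
  have hpath : ∀ t : ℝ, HasDerivAt (fun t : ℝ => x + t • z) z t := fun t => by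
    simpa using ((hasDerivAt_id t).smul_const z).const_add x
  have hderiv : ∀ t : ℝ, HasDerivAt (fun t : ℝ => f (x + t • z)) (fderiv ℝ f (x + t • z) z) t :=
    fun t => ((f.contDiff.differentiable (by simp) (x + t • z)).hasFDerivAt.comp_hasDerivAt t
      (hpath t))
  have hcont : Continuous fun t : ℝ => fderiv ℝ f (x + t • z) :=
    f.continuous_fderiv.comp (by fun_prop)
  have hint := intervalIntegral.integral_eq_sub_of_hasDerivAt (a := 0) (b := 1)
    (fun t _ => hderiv t) ((hcont.clm_apply continuous_const).intervalIntegrable _ _)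
  simp only [one_smul, zero_smul, add_zero] at hint
  rw [← hint, intervalIntegral.integral_of_le zero_le_one]
  refine (enorm_integral_le_lintegral_enorm _).trans ?_
  rw [← lintegral_const_mul _ hcont.enorm.measurable]
  refine lintegral_mono fun t => ?_
  rw [mul_comm]
  exact ContinuousLinearMap.le_opENorm _ _

/-- Integrates the mean value bound along segments. Each slice involves a translate of the gradient,
whose `L^q` norm is unchanged, so translations are uniformly continuous in `L¹` on finite-measure
sets along bounded sequences. -/
theorem TestFun.setLIntegral_enorm_sub_le [Fact (5 ≤ N)] (s : Set (RN N)) (f : TestFun N)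
    (z : RN N) : ∫⁻ x in s, ‖f (x + z) - f x‖ₑ ≤ ‖z‖ₑ *
      (eLpNorm (fderiv ℝ f) (gradExp N) volume *
        volume s ^ (1 - 1 / (gradExp N : ℝ≥0∞).toReal)) := by
  have hcont : Continuous fun q : RN N × ℝ => ‖fderiv ℝ f (q.1 + q.2 • z)‖ₑ :=
    (f.continuous_fderiv.comp (by fun_prop)).enorm
  have hslice : ∀ t : ℝ, ∫⁻ x in s, ‖fderiv ℝ f (x + t • z)‖ₑ
      ≤ eLpNorm (fderiv ℝ f) (gradExp N) volume *
        volume s ^ (1 - 1 / (gradExp N : ℝ≥0∞).toReal) := fun t => by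
    have hmp : MeasurePreserving (fun x : RN N => x + t • z) volume volume :=
      measurePreserving_add_right volume _
    have h1 := setLIntegral_enorm_le (μ := volume) (f := fderiv ℝ f ∘ fun x => x + t • z)
      (f.continuous_fderiv.comp (by fun_prop)).aestronglyMeasurable
      (p := gradExp N) (by exact_mod_cast one_lt_gradExp.le) s
    rwa [eLpNorm_comp_measurePreserving f.continuous_fderiv.aestronglyMeasurable hmp] at h1
  calc ∫⁻ x in s, ‖f (x + z) - f x‖ₑ
      ≤ ∫⁻ x in s, ‖z‖ₑ * ∫⁻ t in Set.Ioc (0 : ℝ) 1, ‖fderiv ℝ f (x + t • z)‖ₑ :=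
        lintegral_mono fun x => f.enorm_sub_le x z
    _ = ‖z‖ₑ * ∫⁻ t in Set.Ioc (0 : ℝ) 1, ∫⁻ x in s, ‖fderiv ℝ f (x + t • z)‖ₑ := by
        rw [lintegral_const_mul' _ _ enorm_ne_top, lintegral_lintegral_swap]
        exact hcont.measurable.aemeasurable
    _ ≤ ‖z‖ₑ * ∫⁻ _t in Set.Ioc (0 : ℝ) 1, (eLpNorm (fderiv ℝ f) (gradExp N) volume *
          volume s ^ (1 - 1 / (gradExp N : ℝ≥0∞).toReal)) :=
        mul_le_mul_right (lintegral_mono fun t => hslice t) _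
    _ = _ := by simp

/-- The mean of `f` over the ball of radius `ε` around `x`. -/
noncomputable def TestFun.ballMean (ε : ℝ) (f : TestFun N) (x : RN N) : ℝ :=
  ⨍ z in Metric.ball (0 : RN N) ε, f (x + z)

theorem TestFun.integrableOn_ball (f : TestFun N) (x : RN N) (ε : ℝ) :
    IntegrableOn (fun z => f (x + z)) (Metric.ball (0 : RN N) ε) :=
  Integrable.integrableOn (((f.continuous.integrable_of_hasCompactSupport
    f.hasCompactSupport)).comp_add_left x)

theorem TestFun.stronglyMeasurable_ballMean (ε : ℝ) (f : TestFun N) :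
    StronglyMeasurable (f.ballMean ε) := by
  have h : StronglyMeasurable fun q : RN N × RN N => f (q.1 + q.2) :=
    (f.continuous.comp continuous_add).stronglyMeasurable
  exact h.integral_prod_right

theorem TestFun.setLIntegral_enorm_sub_ballMean_le [Fact (5 ≤ N)] {ε : ℝ} (hε : 0 < ε)
    (s : Set (RN N)) (f : TestFun N) : ∫⁻ x in s, ‖f x - f.ballMean ε x‖ₑ ≤ ENNReal.ofReal ε *
      (eLpNorm (fderiv ℝ f) (gradExp N) volume *
        volume s ^ (1 - 1 / (gradExp N : ℝ≥0∞).toReal)) := by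
  -- With the ball normalized to a probability measure, `f x - f.ballMean ε x` is an average of the
  -- increments `f x - f (x + z)` with `|z| < ε`.
  set μ : Measure (RN N) := (volume (Metric.ball (0 : RN N) ε))⁻¹ •
    volume.restrict (Metric.ball (0 : RN N) ε) with hμ
  have hpos : volume (Metric.ball (0 : RN N) ε) ≠ 0 := (Metric.measure_ball_pos volume _ hε).ne'
  have hfin : volume (Metric.ball (0 : RN N) ε) ≠ ⊤ := measure_ball_lt_top.ne
  have hprob : IsProbabilityMeasure μ := ⟨by
    rw [hμ, Measure.smul_apply, Measure.restrict_apply_univ, smul_eq_mul,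
      ENNReal.inv_mul_cancel hpos hfin]⟩
  have hmean : ∀ x, f.ballMean ε x = ∫ z, f (x + z) ∂μ := fun x => by
    rw [TestFun.ballMean, average, Measure.restrict_apply_univ]
  have hint : ∀ x, Integrable (fun z => f (x + z)) μ := fun x =>
    (f.integrableOn_ball x ε).smul_measure (ENNReal.inv_ne_top.2 hpos)
  have hae : ∀ᵐ z ∂μ, ‖z‖ₑ ≤ ENNReal.ofReal ε := by
    refine Measure.ae_smul_measure ?_ _
    filter_upwards [ae_restrict_mem Metric.isOpen_ball.measurableSet] with z hz
    rw [← ofReal_norm]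
    exact ENNReal.ofReal_le_ofReal (by simpa using (Metric.mem_ball.1 hz).le)
  calc ∫⁻ x in s, ‖f x - f.ballMean ε x‖ₑ
      ≤ ∫⁻ x in s, ∫⁻ z, ‖f (x + z) - f x‖ₑ ∂μ := by
        refine lintegral_mono fun x => ?_
        have : f x - f.ballMean ε x = -∫ z, (f (x + z) - f x) ∂μ := by
          rw [hmean, integral_sub (hint x) (integrable_const _)]
          simp
        rw [this, enorm_neg]
        exact enorm_integral_le_lintegral_enorm _
    _ = ∫⁻ z, (∫⁻ x in s, ‖f (x + z) - f x‖ₑ) ∂μ := by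
        rw [lintegral_lintegral_swap]
        exact (Continuous.enorm ((f.continuous.comp continuous_add).sub
          (f.continuous.comp continuous_fst))).measurable.aemeasurable
    _ ≤ ∫⁻ _z, ENNReal.ofReal ε * (eLpNorm (fderiv ℝ f) (gradExp N) volume *
          volume s ^ (1 - 1 / (gradExp N : ℝ≥0∞).toReal)) ∂μ := by
        refine lintegral_mono_ae ?_
        filter_upwards [hae] with z hz
        exact (f.setLIntegral_enorm_sub_le s z).trans (mul_le_mul_left hz _)
    _ = _ := by simp

/-- The integral over a translated ball is a continuous functional on `𝓓^{2,2}`. -/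
theorem exists_clm_ballMean [Fact (5 ≤ N)] (ε : ℝ) (x : RN N) :
    ∃ φ : D22 N →L[ℝ] ℝ, ∀ f : TestFun N, φ (f : D22 N) = f.ballMean ε x := by
  obtain ⟨S, hS⟩ := TestFun.sobolev N
  let B : Set (RN N) := Metric.ball (0 : RN N) ε
  let ℓ : TestFun N →ₗ[ℝ] ℝ :=
    { toFun := fun f => f.ballMean ε x
      map_add' := fun f g => by
        have h := integral_add (f.integrableOn_ball x ε) (g.integrableOn_ball x ε)
        simp only [TestFun.ballMean, setAverage_eq, ← smul_add]
        rw [← h]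
        rfl
      map_smul' := fun c f => by
        have h := integral_const_mul (μ := volume.restrict B) c (fun z => f (x + z))
        simp only [TestFun.ballMean, setAverage_eq, RingHom.id_apply]
        rw [smul_comm, smul_eq_mul c, ← h]
        rfl }
  let θ : ℝ := 1 - 1 / (ENNReal.ofReal (critExp N)).toReal
  have hθ : 0 ≤ θ := by
    simp only [θ]
    rw [toReal_critExp, sub_nonneg, div_le_one critExp_pos]
    exact one_le_critExp
  let b : ℝ := (volume.real B)⁻¹ * (S * (volume B ^ θ).toReal)
  have hbound : ∀ f : TestFun N, ‖ℓ f‖ ≤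
      b * ‖(UniformSpace.Completion.toComplL (𝕜 := ℝ) : TestFun N →L[ℝ] D22 N).toLinearMap f‖ := by
    intro f
    change ‖f.ballMean ε x‖ ≤ b * ‖(f : D22 N)‖
    rw [UniformSpace.Completion.norm_coe, TestFun.ballMean, setAverage_eq, norm_smul,
      Real.norm_of_nonneg (inv_nonneg.2 measureReal_nonneg), mul_assoc]
    refine mul_le_mul_of_nonneg_left ?_ (inv_nonneg.2 measureReal_nonneg)
    have hmp : MeasurePreserving (fun z : RN N => x + z) volume volume :=
      measurePreserving_add_left volume x
    have h1 := setLIntegral_enorm_le (μ := volume) (f := f ∘ fun z => x + z)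
      (f.continuous.comp (by fun_prop)).aestronglyMeasurable
      (p := ENNReal.ofReal (critExp N)) Fact.out B
    rw [eLpNorm_comp_measurePreserving f.continuous.aestronglyMeasurable hmp] at h1
    have h2 : ‖∫ z in B, f (x + z)‖ₑ ≤ S * ENNReal.ofReal ‖f‖ * volume B ^ θ :=
      (enorm_integral_le_lintegral_enorm _).trans (h1.trans (mul_le_mul_left (hS f) _))
    have hfin : S * ENNReal.ofReal ‖f‖ * volume B ^ θ ≠ ⊤ :=
      ENNReal.mul_ne_top (ENNReal.mul_ne_top ENNReal.coe_ne_top ENNReal.ofReal_ne_top)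
        (ENNReal.rpow_ne_top_of_nonneg hθ measure_ball_lt_top.ne)
    have h3 := ENNReal.toReal_mono hfin h2
    rw [toReal_enorm, ENNReal.toReal_mul, ENNReal.toReal_mul, ENNReal.coe_toReal,
      ENNReal.toReal_ofReal (norm_nonneg _)] at h3
    exact h3.trans_eq (by ring)
  exact ⟨ℓ.extendOfNorm
    (UniformSpace.Completion.toComplL (𝕜 := ℝ) : TestFun N →L[ℝ] D22 N).toLinearMap,
    fun f => LinearMap.extendOfNorm_eq (f := ℓ)
      (e := (UniformSpace.Completion.toComplL (𝕜 := ℝ) : TestFun N →L[ℝ] D22 N).toLinearMap)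
      UniformSpace.Completion.denseRange_coe ⟨b, hbound⟩ f⟩

variable [Fact (5 ≤ N)]

/-- Local compactness of the embedding for test functions: a bounded sequence which converges
weakly to `0` converges to `0` in measure on balls. -/
theorem TestFun.tendsto_measure_ball_inter {f : ℕ → TestFun N} {C : ℝ} (hC : ∀ n, ‖f n‖ ≤ C)
    (hf : ∀ φ : D22 N →L[ℝ] ℝ, Tendsto (fun n => φ (f n : D22 N)) atTop (𝓝 0)) (R : ℝ)
    {a : ℝ} (ha : 0 < a) :
    Tendsto (fun n => volume (Metric.ball (0 : RN N) R ∩ {x | a ≤ |f n x|})) atTop (𝓝 0) := by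
  obtain ⟨G, hG⟩ := TestFun.eLpNorm_fderiv_le N
  set B : Set (RN N) := Metric.ball 0 R
  have hB : MeasurableSet B := Metric.isOpen_ball.measurableSet
  have hBtop : volume B ≠ ⊤ := measure_ball_lt_top.ne
  have hfinB : IsFiniteMeasure (volume.restrict B) := ⟨by
    rw [Measure.restrict_apply_univ]; exact hBtop.lt_top⟩
  have hexp : 0 ≤ 1 - 1 / (gradExp N : ℝ≥0∞).toReal := by linarith [one_div_gradExp_lt (N := N)]
  have ha2 : 0 < a / 2 := half_pos ha
  refine tendsto_zero_of_le_add (C := (ENNReal.ofReal (a / 2))⁻¹ * (G * ENNReal.ofReal C *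
    volume B ^ (1 - 1 / (gradExp N : ℝ≥0∞).toReal))) ?_ fun ε hε => ?_
  · exact ENNReal.mul_ne_top (ENNReal.inv_ne_top.2 (by simpa using ha))
      (ENNReal.mul_ne_top (ENNReal.mul_ne_top ENNReal.coe_ne_top ENNReal.ofReal_ne_top)
        (ENNReal.rpow_ne_top_of_nonneg hexp hBtop))
  -- The averaging radius is `ε` itself. The means are values of fixed continuous functionals, so
  -- they tend to `0` pointwise and hence in measure on `B`; the distance of `f n` to its mean is
  -- `O(ε)` in `L¹(B)`, uniformly in `n`.
  refine ⟨fun n => volume (B ∩ {x | a / 2 ≤ |(f n).ballMean ε x|}), ?_, fun n => ?_⟩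
  · have hptw : ∀ x, Tendsto (fun n => (f n).ballMean ε x) atTop (𝓝 0) := fun x => by
      obtain ⟨φ, hφ⟩ := exists_clm_ballMean (N := N) ε x
      simpa only [hφ] using hf φ
    have h := tendstoInMeasure_of_tendsto_ae (μ := volume.restrict B)
      (f := fun n => (f n).ballMean ε) (g := fun _ => 0)
      (fun n => ((f n).stronglyMeasurable_ballMean ε).aestronglyMeasurable)
      (Eventually.of_forall hptw) (ENNReal.ofReal (a / 2)) (by simpa using ha)
    refine h.congr fun n => ?_
    rw [Measure.restrict_apply' hB, Set.inter_comm]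
    congr 2
    ext x
    simp only [Set.mem_ofPred_eq]
    rw [edist_zero_right, Real.enorm_eq_ofReal_abs, ENNReal.ofReal_le_ofReal_iff (abs_nonneg _)]
  · have h1 := measure_inter_abs_ge_le_add (μ := (volume : Measure (RN N)))
      (f := f n) (g := (f n).ballMean ε) (d := fun x => f n x - (f n).ballMean ε x)
      (EventuallyEq.refl _ _) B a
    refine h1.trans ?_
    rw [add_comm]
    refine add_le_add ?_ le_rfl
    refine (Biharmonic.measure_inter_abs_ge_le ((f n).continuous.aestronglyMeasurable.sub
      ((f n).stronglyMeasurable_ballMean ε).aestronglyMeasurable) hB ha2).trans ?_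
    calc _ ≤ (ENNReal.ofReal (a / 2))⁻¹ * (ENNReal.ofReal ε * (G * ENNReal.ofReal C *
          volume B ^ (1 - 1 / (gradExp N : ℝ≥0∞).toReal))) := by
          refine mul_le_mul_right (((f n).setLIntegral_enorm_sub_ballMean_le hε B).trans ?_) _
          refine mul_le_mul_right (mul_le_mul_left ((hG (f n)).trans ?_) _) _
          exact mul_le_mul_right (ENNReal.ofReal_le_ofReal (hC n)) _
      _ = _ := by ring

/-- A bounded sequence which converges weakly to `0` converges to `0` in measure on balls. -/
theorem D22.tendsto_measure_ball_inter {u : ℕ → D22 N} {C : ℝ} (hC : ∀ n, ‖u n‖ ≤ C)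
    (hu : Tendsto (fun n => toWeakSpace ℝ (D22 N) (u n)) atTop (𝓝 0)) (R : ℝ)
    {a : ℝ} (ha : 0 < a) :
    Tendsto (fun n => volume (Metric.ball (0 : RN N) R ∩ {x | a ≤ |u n x|})) atTop (𝓝 0) := by
  rw [D22.tendsto_toWeakSpace_iff] at hu
  obtain ⟨f, hf1, hf0⟩ := D22.exists_testFun_approx u
  have hfC : ∀ n, ‖f n‖ ≤ C + 1 := fun n => D22.norm_testFun_le (hC n) (hf1 n)
  have hf : ∀ φ : D22 N →L[ℝ] ℝ, Tendsto (fun n => φ (f n : D22 N)) atTop (𝓝 0) := fun φ => by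
    have h := (φ.continuous.tendsto 0).comp (tendsto_zero_iff_norm_tendsto_zero.2 hf0)
    rw [map_zero] at h
    simpa using (hu φ).sub h
  have hsum := (TestFun.tendsto_measure_ball_inter hfC hf R (half_pos ha)).add
    (D22.tendsto_measure_of_norm hf0 (half_pos ha))
  rw [add_zero] at hsum
  exact tendsto_of_tendsto_of_tendsto_of_le_of_le tendsto_const_nhds hsum (fun n => zero_le)
    fun n => D22.measure_inter_abs_ge_le_testFun (u n) (f n) _ a

end Compactness

/-! ### Lattice translations and smallness on balls. -/

section Translation

variable {N : ℕ}

theorem D22.norm_translate (y : RN N) (u : D22 N) : ‖D22.translate y u‖ = ‖u‖ := by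
  induction u using UniformSpace.Completion.induction_on with
  | hp => exact isClosed_eq (D22.translate y).continuous.norm continuous_norm
  | ih f =>
    rw [D22.translate_coe, UniformSpace.Completion.norm_coe, UniformSpace.Completion.norm_coe,
      TestFun.norm_translate]

theorem exists_ofInt_ball_subset (y : RN N) (r : ℝ) :
    ∃ k : Fin N → ℤ, Metric.ball y r ⊆ Metric.ball (ofInt k) (r + √N) := by
  -- Rounding down moves each coordinate by less than `1`, hence the point by at most `√N`.
  refine ⟨fun i => ⌊y i⌋, Metric.ball_subset_ball' ?_⟩
  gcongr
  rw [EuclideanSpace.dist_eq]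
  refine Real.sqrt_le_sqrt ?_
  calc ∑ i, dist (y i) (ofInt (fun i => ⌊y i⌋) i) ^ 2 ≤ ∑ _i : Fin N, (1 : ℝ) := by
        refine Finset.sum_le_sum fun i _ => ?_
        change dist (y i) (⌊y i⌋ : ℝ) ^ 2 ≤ 1
        rw [Real.dist_eq, Int.self_sub_floor, abs_of_nonneg (Int.fract_nonneg _)]
        nlinarith [Int.fract_nonneg (y i), Int.fract_lt_one (y i)]
    _ = N := by simp

variable [Fact (5 ≤ N)]

theorem D22.measure_ball_inter_translate (u : D22 N) (y : RN N) (R a : ℝ) :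
    volume (Metric.ball 0 R ∩ {x | a ≤ |D22.translate y u x|})
      = volume (Metric.ball y R ∩ {x | a ≤ |u x|}) := by
  have hmp : MeasurePreserving (fun x : RN N => x + y) volume volume :=
    measurePreserving_add_right volume y
  have h1 := hmp.measure_preimage (s := Metric.ball y R ∩ {x | a ≤ |u x|})
    (Metric.isOpen_ball.measurableSet.nullMeasurableSet.inter (u.nullMeasurableSet_abs_ge a))
  rw [← h1]
  refine measure_congr ?_
  filter_upwards [D22.translate_ae_eq y u] with x hx
  refine propext (and_congr ?_ ?_)
  · change x ∈ Metric.ball 0 R ↔ x + y ∈ Metric.ball y R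
    simp [dist_eq_norm]
  · change a ≤ |D22.translate y u x| ↔ a ≤ |u (x + y)|
    rw [hx]

/-- If all integer translates of a bounded sequence converge weakly to `0`, then the superlevel
sets vanish uniformly on balls. -/
theorem D22.tendsto_iSup_ball_of_translate {u : ℕ → D22 N} {C : ℝ} (hC : ∀ n, ‖u n‖ ≤ C)
    (hu : ∀ y : ℕ → Fin N → ℤ, Tendsto (fun n => toWeakSpace ℝ (D22 N)
      (D22.translate (ofInt (y n)) (u n))) atTop (𝓝 0)) (r : ℝ) {a : ℝ} (ha : 0 < a) :
    Tendsto (fun n => ⨆ y : RN N, volume (Metric.ball y r ∩ {x | a ≤ |u n x|})) atTop (𝓝 0) := by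
  set R : ℝ := r + √N
  set g : ℕ → (Fin N → ℤ) → ℝ≥0∞ := fun n k =>
    volume (Metric.ball (ofInt k) R ∩ {x | a ≤ |u n x|})
  have hgtop : ∀ n, ⨆ k, g n k ≠ ⊤ := fun n => by
    refine ((iSup_le fun k => ?_).trans_lt
      (measure_ball_lt_top (μ := volume) (x := (0 : RN N)) (r := R))).ne
    rw [← Measure.addHaar_ball_center volume (ofInt k) R]
    exact measure_mono Set.inter_subset_left
  -- A centre attaining the supremum up to `1 / n`; for `n = 0` the error is `⊤`. The hypothesis on
  -- translates is then used only along this choice.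
  have hex : ∀ n : ℕ, ∃ k, ⨆ k, g n k ≤ g n k + ((n : ℝ≥0∞))⁻¹ := fun n => by
    rcases eq_or_ne (⨆ k, g n k) 0 with h0 | h0
    · exact ⟨0, h0.trans_le zero_le⟩
    · have hlt := ENNReal.sub_lt_self (hgtop n) h0
        (ENNReal.inv_ne_zero.2 (ENNReal.natCast_ne_top n))
      obtain ⟨k, hk⟩ := lt_iSup_iff.1 hlt
      exact ⟨k, tsub_le_iff_right.1 hk.le⟩
  choose k hk using hex
  have hlim := D22.tendsto_measure_ball_inter (C := C)
    (fun n => (D22.norm_translate _ (u n)).trans_le (hC n)) (hu k) R ha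
  simp only [D22.measure_ball_inter_translate] at hlim
  have hsum := hlim.add ENNReal.tendsto_inv_nat_nhds_zero
  rw [add_zero] at hsum
  refine tendsto_of_tendsto_of_tendsto_of_le_of_le tendsto_const_nhds hsum (fun n => zero_le)
    fun n => (iSup_le fun y => ?_).trans (hk n)
  obtain ⟨m, hm⟩ := exists_ofInt_ball_subset y r
  exact (measure_mono (Set.inter_subset_inter_left _ hm)).trans (le_iSup (g n) m)

theorem D22.tendsto_iSup_ball_of_sq {u : ℕ → D22 N} {r : ℝ}
    (hu : Tendsto (fun n => ⨆ y : RN N, ∫⁻ x in Metric.ball y r, ‖u n x‖ₑ ^ 2) atTop (𝓝 0))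
    {a : ℝ} (ha : 0 < a) :
    Tendsto (fun n => ⨆ y : RN N, volume (Metric.ball y r ∩ {x | a ≤ |u n x|})) atTop (𝓝 0) := by
  have ha2 : 0 < a ^ 2 := by positivity
  have hlim : Tendsto (fun n => (ENNReal.ofReal (a ^ 2))⁻¹ *
      ⨆ y : RN N, ∫⁻ x in Metric.ball y r, ‖u n x‖ₑ ^ 2) atTop (𝓝 0) := by
    simpa using ENNReal.Tendsto.const_mul hu
      (Or.inr (ENNReal.inv_ne_top.2 (ENNReal.ofReal_pos.2 ha2).ne'))
  refine tendsto_of_tendsto_of_tendsto_of_le_of_le tendsto_const_nhds hlim (fun n => zero_le)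
    fun n => iSup_le fun y => ?_
  have h := measure_inter_abs_ge_le (μ := volume) (f := fun x => u n x ^ 2)
    ((u n).aestronglyMeasurable.pow 2) (Metric.isOpen_ball (x := y) (ε := r)).measurableSet ha2
  simp only [enorm_pow, abs_pow, sq_le_sq₀ ha.le (abs_nonneg _)] at h
  exact h.trans (mul_le_mul_right
    (le_iSup (fun y : RN N => ∫⁻ x in Metric.ball y r, ‖u n x‖ₑ ^ 2) y) _)

/-- Volume is translation invariant, so the condition on `u n` handles every sequence of shifts at
once. -/
theorem D22.tendsto_measure_translate {u : ℕ → D22 N} (y : ℕ → RN N) {a : ℝ}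
    (hu : Tendsto (fun n => volume {x | a ≤ |u n x|}) atTop (𝓝 0)) :
    Tendsto (fun n => volume {x | a ≤ |D22.translate (y n) (u n) x|}) atTop (𝓝 0) := by
  refine hu.congr fun n => ?_
  have hmp : MeasurePreserving (fun x : RN N => x + y n) volume volume :=
    measurePreserving_add_right volume (y n)
  rw [← hmp.measure_preimage ((u n).nullMeasurableSet_abs_ge a)]
  refine measure_congr ?_
  filter_upwards [D22.translate_ae_eq (y n) (u n)] with x hx
  change (a ≤ |u n (x + y n)|) = (a ≤ |D22.translate (y n) (u n) x|)
  rw [hx]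

end Translation

end Biharmonic

theorem lemma4p1 (N : ℕ) [Fact (5 ≤ N)] :
    -- the integrals of `Ψ(u)` make sense
    (∀ (u : Biharmonic.D22 N) (Ψ : ℝ → ℝ), Biharmonic.IsSubcritical N Ψ →
      Integrable (fun x => Ψ (u x)) volume) ∧
    -- the Lions lemma
    (∀ u : ℕ → Biharmonic.D22 N, (∃ C : ℝ, ∀ n, ‖u n‖ ≤ C) →
      (∃ r : ℝ, 0 < r ∧
        Tendsto (fun n => ⨆ y : Biharmonic.RN N, ∫⁻ x in Metric.ball y r, ‖u n x‖ₑ ^ 2)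
          atTop (𝓝 0)) →
      ∀ Ψ : ℝ → ℝ, Biharmonic.IsSubcritical N Ψ →
        Tendsto (fun n => ∫ x, Ψ (u n x)) atTop (𝓝 0)) ∧
    -- the characterization by weak convergence of all integer translates
    (∀ u : ℕ → Biharmonic.D22 N, (∃ C : ℝ, ∀ n, ‖u n‖ ≤ C) →
      ((∀ y : ℕ → Fin N → ℤ,
          Tendsto (fun n => toWeakSpace ℝ (Biharmonic.D22 N)
            (Biharmonic.D22.translate (Biharmonic.ofInt (y n)) (u n))) atTop (𝓝 0)) ↔
        ∀ Ψ : ℝ → ℝ, Biharmonic.IsSubcritical N Ψ →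
          Tendsto (fun n => ∫ x, Ψ (u n x)) atTop (𝓝 0))) := by
  refine ⟨fun u Ψ hΨ => hΨ.integrable u, ?_, ?_⟩
  · rintro u ⟨C, hC⟩ ⟨r, hr, hu⟩ Ψ hΨ
    exact hΨ.tendsto_integral hC fun a ha =>
      Biharmonic.D22.tendsto_measure_of_tendsto_iSup_ball hC hr
        (fun b hb => Biharmonic.D22.tendsto_iSup_ball_of_sq hu hb) ha
  · rintro u ⟨C, hC⟩
    constructor
    · intro hu Ψ hΨ
      exact hΨ.tendsto_integral hC fun a ha =>
        -- The radius `1` is arbitrary: vanishing of the translates controls balls of every radius.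
        Biharmonic.D22.tendsto_measure_of_tendsto_iSup_ball hC one_pos
          (fun b hb => Biharmonic.D22.tendsto_iSup_ball_of_translate hC hu 1 hb) ha
    · intro hu y
      exact Biharmonic.D22.tendsto_toWeakSpace_of_tendsto_measure
        (fun n => (Biharmonic.D22.norm_translate _ (u n)).trans_le (hC n)) fun a ha =>
          Biharmonic.D22.tendsto_measure_translate _
            (Biharmonic.D22.tendsto_measure_of_integral hu ha)
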